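/- **Setting.** Let $L\subset\mathbb Z^2$ be a valid lattice, i.e. generated by two linearly independent vectors each of which has its coordinates both even or both odd, and let $\mathbb T_L=\mathbb R^2/L$. Unit squares are coloured like a checkerboard with $[0,1]^2$ black. A tiling $t$ of $\mathbb T_L$ is an $L$-periodic domino tiling of the square lattice. Orient the edges of $\mathbb Z^2$ clockwise around black squares; the height function $h_t:\mathbb Z^2\to\mathbb Z$ has $h_t(0)=0$ and changes along an edge, in the direction of its orientation, by $+1$ if the edge crosses no domino of $t$ and by $-3$ if it crosses one. The flux of $t$ is the vector $\varphi_t\in\mathbb R^2$ with $h_t(v+u)-h_t(v)=4\langle\varphi_t,u\rangle$ for all $v\in\mathbb Z^2$, $u\in L$; $\mathscr F(L)$ is the set of fluxes of tilings of $\mathbb T_L$. **Kasteleyn matrix.** Let $x_0>0$ be minimal with $v_0=(x_0,0)\in L$, let $y_1>0$ be minimal such that the line $y=y_1$ meets $L$, and let $v_1=(x_1,y_1)\in L$ with $0\le x_1<x_0$. Let $u(0)$ be the straight edge-path from $0$ to $v_0$ and $u(1)$ the edge-path from $0$ up to $(0,y_1)$ and then right to $v_1$. Enumerate arbitrarily the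 black squares $b_1,\dots,b_n$ and the white squares $w_1,\dots,w_n$ of the rectangle $[0,x_0]\times[0,y_1]$ (there are equally many of each). A brick wall is one of the four tilings of the plane in which every black square is joined to its neighbour in one fixed direction (right, up, left or down). Fix a brick wall and give the sign $-1$ to the dual edges (pairs of adjacent squares) in it and $+1$ to all others, or vice versa. The weight of an $L$-class of dual edges is its sign, times $q_k^{+1}$ (resp. $q_k^{-1}$), for each $k\in\{0,1\}$ such that an edge of the class crosses $u(k)$ and a domino there causes a height change of $+3$ (resp. $-3$) along $u(k)$. The entry $K_{ij}$ is the sum of the weights of all classes of dual edges joining $b_i$ to $w_j$ modulo $L$ ($0$ if there is none). Thus $\det K$ is a Laurent polynomial in $q_0,q_1$, and each tiling $t$ of $\mathbb T_L$ corresponds to a term $K_t=\operatorname{sgn}(\sigma)\prod_i(\text{weight of the class of the domino of } t \text{ on } b_i)$ of its full expansion, where $t$ joins $b_i$ to $w_{\sigma(i)}$ modulo $L$. **Proposition.** Let $\varphi\in\mathscr F(L)$. Put $s_k=0$ if the coordinates of $v_k$ are even and $s_k=\tfrac12$ if they are odd. Then $i=\langle\varphi,v_0\rangle-s_0$ and $j=\langle\varphi,v_1\rangle-s_1$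 are integers; there is a sign $\varepsilon\in\{1,-1\}$ such that $K_t=\varepsilon\,q_0^iq_1^j$ for every tiling $t$ of $\mathbb T_L$ with flux $\varphi$; and the coefficient $c_{ij}$ of $q_0^iq_1^j$ in $\det K$ satisfies $$|c_{ij}|=\#\{\text{tilings of }\mathbb T_L\text{ with flux }\varphi\}.$$ -/

import Mathlib

namespace TorusDomino

noncomputable section

open scoped Classical

/-! ### Lattices and squares

A unit square of the plane with vertices in `ℤ × ℤ` is represented by its lower left corner. -/

/-- `v` has both coordinates even or both coordinates odd. -/
def SameParity (v : ℤ × ℤ) : Prop :=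
  (Even v.1 ∧ Even v.2) ∨ (Odd v.1 ∧ Odd v.2)

/-- A valid lattice: generated by two linearly independent integer vectors, each of which has
coordinates that are both even or both odd. -/
def IsValidLattice (L : AddSubgroup (ℤ × ℤ)) : Prop :=
  ∃ v w : ℤ × ℤ, L = AddSubgroup.closure {v, w} ∧ v.1 * w.2 - v.2 * w.1 ≠ 0 ∧
    SameParity v ∧ SameParity w

/-- The checkerboard colouring in which the square `[0,1]²` is black. -/
def Black (p : ℤ × ℤ) : Prop := Even (p.1 + p.2)

/-- The four unit steps from a square to its neighbours. -/
def unitSteps : Finset (ℤ × ℤ) := {(1, 0), (0, 1), (-1, 0), (0, -1)}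

/-! ### Tilings of the torus -/

/-- The pair of squares `d` is a domino (equivalently, an edge of the dual graph of `ℤ²`). -/
def IsDomino (d : Sym2 (ℤ × ℤ)) : Prop :=
  ∃ p : ℤ × ℤ, ∃ δ ∈ unitSteps, d = s(p, p + δ)

/-- The translate of a domino by a vector. -/
def translate (v : ℤ × ℤ) (d : Sym2 (ℤ × ℤ)) : Sym2 (ℤ × ℤ) := d.map (fun p => p + v)

/-- A domino tiling of the infinite square lattice: a set of dominoes such that every square
lies in exactly one of them. -/
def IsTiling (t : Set (Sym2 (ℤ × ℤ))) : Prop :=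
  (∀ d ∈ t, IsDomino d) ∧ ∀ p : ℤ × ℤ, ∃! d, d ∈ t ∧ p ∈ d

/-- The tilings of the torus `ℝ² / L`, as `L`-periodic tilings of the infinite square lattice. -/
def torusTilings (L : AddSubgroup (ℤ × ℤ)) : Set (Set (Sym2 (ℤ × ℤ))) :=
  {t | IsTiling t ∧ ∀ v ∈ L, ∀ d ∈ t, translate v d ∈ t}

/-! ### Height functions and flux -/

/-- An edge of the grid `ℤ²` traversed in the positive direction: `right v` goes from `v` to
`v + (1, 0)` and `up v` goes from `v` to `v + (0, 1)`. -/
inductive GridEdge where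
  | right (v : ℤ × ℤ)
  | up (v : ℤ × ℤ)

namespace GridEdge

/-- The initial vertex. -/
def source : GridEdge → ℤ × ℤ
  | right v => v
  | up v => v

/-- The final vertex. -/
def target : GridEdge → ℤ × ℤ
  | right v => v + (1, 0)
  | up v => v + (0, 1)

/-- The square on the left of the traversed edge. -/
def leftSquare : GridEdge → ℤ × ℤ
  | right v => v
  | up v => v - (1, 0)

/-- The square on the right of the traversed edge. -/
def rightSquare : GridEdge → ℤ × ℤ
  | right v => v - (0, 1)
  | up v => v

/-- The domino crossed by the edge (the dual edge). -/
def crossed (e : GridEdge) : Sym2 (ℤ × ℤ) := s(e.leftSquare, e.rightSquare)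

end GridEdge

/-- `h` is the height function of the tiling `t`, with value `0` at the origin. Grid edges are
oriented clockwise around black squares. Along an edge that crosses no domino of `t` the height
changes by `+1` in the direction of that orientation; along an edge that crosses a domino of `t`
it changes by `-3` in that direction. -/
def IsHeightFunction (t : Set (Sym2 (ℤ × ℤ))) (h : ℤ × ℤ → ℤ) : Prop :=
  h 0 = 0 ∧ ∀ e : GridEdge, h e.target - h e.source =
    if e.crossed ∈ t then (if Black e.rightSquare then -3 else 3)
    else (if Black e.rightSquare then 1 else -1)

/-- The inner product of a real vector and an integer vector of the plane. -/
def pairing (φ : ℝ × ℝ) (u : ℤ × ℤ) : ℝ := φ.1 * u.1 + φ.2 * u.2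

/-- The tiling `t` of `ℝ² / L` has flux `φ`: its height function satisfies
`h (v + u) - h v = 4 ⟨φ, u⟩` for all vertices `v` and all `u ∈ L`. -/
def HasFlux (L : AddSubgroup (ℤ × ℤ)) (t : Set (Sym2 (ℤ × ℤ))) (φ : ℝ × ℝ) : Prop :=
  ∃ h : ℤ × ℤ → ℤ, IsHeightFunction t h ∧
    ∀ v : ℤ × ℤ, ∀ u ∈ L, ((h (v + u) - h v : ℤ) : ℝ) = 4 * pairing φ u

/-- The tilings of `ℝ² / L` with flux `φ`. -/
def tilingsWithFlux (L : AddSubgroup (ℤ × ℤ)) (φ : ℝ × ℝ) : Set (Set (Sym2 (ℤ × ℤ))) :=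
  {t | t ∈ torusTilings L ∧ HasFlux L t φ}

/-- The set of all flux values of tilings of `ℝ² / L`. -/
def fluxSet (L : AddSubgroup (ℤ × ℤ)) : Set (ℝ × ℝ) :=
  {φ | (tilingsWithFlux L φ).Nonempty}

/-! ### The rectangular fundamental domain -/

/-- The smallest positive integer `x₀` with `(x₀, 0) ∈ L`. -/
def baseX (L : AddSubgroup (ℤ × ℤ)) : ℕ := sInf {n : ℕ | 0 < n ∧ ((n : ℤ), (0 : ℤ)) ∈ L}

/-- The smallest positive integer `y₁` for which the line at height `y₁` meets `L`. -/
def baseY (L : AddSubgroup (ℤ × ℤ)) : ℕ := sInf {n : ℕ | 0 < n ∧ ∃ x : ℤ, (x, (n : ℤ)) ∈ L}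

/-- The only integer `0 ≤ x₁ < x₀` with `(x₁, y₁) ∈ L`. -/
def shiftX (L : AddSubgroup (ℤ × ℤ)) : ℕ :=
  sInf {n : ℕ | n < baseX L ∧ ((n : ℤ), (baseY L : ℤ)) ∈ L}

/-- The vector `v₀ = (x₀, 0)`. -/
def v0 (L : AddSubgroup (ℤ × ℤ)) : ℤ × ℤ := (baseX L, 0)

/-- The vector `v₁ = (x₁, y₁)`. -/
def v1 (L : AddSubgroup (ℤ × ℤ)) : ℤ × ℤ := (shiftX L, baseY L)

/-- The straight edge-path from the origin to `v₀`. -/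
def path0 (L : AddSubgroup (ℤ × ℤ)) : List GridEdge :=
  (List.range (baseX L)).map fun k => GridEdge.right ((k : ℤ), 0)

/-- The L-shaped edge-path from the origin to `v₁`: first up, then to the right. -/
def path1 (L : AddSubgroup (ℤ × ℤ)) : List GridEdge :=
  ((List.range (baseY L)).map fun k => GridEdge.up (0, (k : ℤ))) ++
    (List.range (shiftX L)).map fun k => GridEdge.right ((k : ℤ), (baseY L : ℤ))

/-- The squares of the fundamental domain `[0, x₀] × [0, y₁]`. -/
def domainSquares (L : AddSubgroup (ℤ × ℤ)) : Set (ℤ × ℤ) :=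
  {p | 0 ≤ p.1 ∧ p.1 < baseX L ∧ 0 ≤ p.2 ∧ p.2 < baseY L}

/-- The black squares of the fundamental domain. -/
def blackSquares (L : AddSubgroup (ℤ × ℤ)) : Set (ℤ × ℤ) := {p | p ∈ domainSquares L ∧ Black p}

/-- The white squares of the fundamental domain. -/
def whiteSquares (L : AddSubgroup (ℤ × ℤ)) : Set (ℤ × ℤ) := {p | p ∈ domainSquares L ∧ ¬ Black p}

/-! ### The Kasteleyn matrix -/

/-- The four brick walls: the brick wall of direction `β` joins every black square to its
neighbour in direction `β`. -/
def brickWall (β : ℤ × ℤ) : Set (Sym2 (ℤ × ℤ)) := {d | ∃ p, Black p ∧ d = s(p, p + β)}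

/-- The universal signings coming from the brick wall of direction `β`: the sign `-η` on the
edges in the brick wall and `η` on all other edges. -/
def kasteleynSign (β : ℤ × ℤ) (η : ℤˣ) (d : Sym2 (ℤ × ℤ)) : ℤ :=
  if d ∈ brickWall β then -(η : ℤ) else (η : ℤ)

/-- The exponent contributed by an edge-path `γ` to the class modulo `L` of the dual edge `d`:
`+1` (`-1`) if `γ` crosses an edge of this class and the height change along `γ` that a domino
there causes is `+3` (`-3`), and `0` if `γ` crosses no edge of this class. -/
def crossingExponent (L : AddSubgroup (ℤ × ℤ)) (γ : List GridEdge) (d : Sym2 (ℤ × ℤ)) : ℤ :=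
  (γ.map fun e => if ∃ v ∈ L, translate v d = e.crossed then
    (if Black e.rightSquare then (-1 : ℤ) else 1) else 0).sum

/-- Laurent polynomials in `q₀, q₁` with integer coefficients: `single (i, j) c` is
`c q₀ⁱ q₁ʲ`. -/
abbrev Laurent : Type := AddMonoidAlgebra ℤ (ℤ × ℤ)

/-- The weight of the class modulo `L` of the dual edge `d`. -/
def weight (L : AddSubgroup (ℤ × ℤ)) (β : ℤ × ℤ) (η : ℤˣ) (d : Sym2 (ℤ × ℤ)) : Laurent :=
  AddMonoidAlgebra.single (crossingExponent L (path0 L) d, crossingExponent L (path1 L) d)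
    (kasteleynSign β η d)

variable {n : ℕ}

/-- The Kasteleyn matrix of `ℝ² / L` for the enumerations `b`, `w` of the black and white squares
of the fundamental domain: the entry `(i, j)` is the sum of the weights of all classes of dual
edges that join the `i`-th black square to the `j`-th white square. Every class of dual edges
at the `i`-th black square `b i` has exactly one representative `{b i, b i + δ}`. -/
def kasteleynMatrix (L : AddSubgroup (ℤ × ℤ)) (β : ℤ × ℤ) (η : ℤˣ)
    (b : Fin n ≃ blackSquares L) (w : Fin n ≃ whiteSquares L) : Matrix (Fin n) (Fin n) Laurent :=
  fun i j => ∑ δ ∈ unitSteps,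
    if (b i : ℤ × ℤ) + δ - (w j : ℤ × ℤ) ∈ L then weight L β η s((b i : ℤ × ℤ), (b i : ℤ × ℤ) + δ)
    else 0

/-- `T` is the term of the expansion of the determinant of the Kasteleyn matrix that corresponds
to the tiling `t`: here `σ` is the permutation such that `t` joins the `i`-th black square to the
`σ i`-th white square modulo `L`, and `δ i` is the direction of the domino on the `i`-th black
square. -/
def IsExpansionTerm (L : AddSubgroup (ℤ × ℤ)) (β : ℤ × ℤ) (η : ℤˣ)
    (b : Fin n ≃ blackSquares L) (w : Fin n ≃ whiteSquares L)
    (t : Set (Sym2 (ℤ × ℤ))) (T : Laurent) : Prop :=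
  ∃ (σ : Equiv.Perm (Fin n)) (δ : Fin n → ℤ × ℤ),
    (∀ i, δ i ∈ unitSteps ∧ s((b i : ℤ × ℤ), (b i : ℤ × ℤ) + δ i) ∈ t ∧
      (b i : ℤ × ℤ) + δ i - (w (σ i) : ℤ × ℤ) ∈ L) ∧
    T = ((Equiv.Perm.sign σ : ℤˣ) : ℤ) •
      ∏ i, weight L β η s((b i : ℤ × ℤ), (b i : ℤ × ℤ) + δ i)

/-- The difference between the flux through `v ∈ L` and the corresponding exponent in the
Kasteleyn determinant: `0` if the coordinates of `v` are even, `1/2` if they are odd. -/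
def parityShift (v : ℤ × ℤ) : ℝ := if Even v.1 then 0 else 1 / 2

/-- The monomial `q₀ⁱ q₁ʲ` corresponds to the flux `φ`. -/
def CorrespondsToFlux (L : AddSubgroup (ℤ × ℤ)) (φ : ℝ × ℝ) (i j : ℤ) : Prop :=
  pairing φ (v0 L) = i + parityShift (v0 L) ∧ pairing φ (v1 L) = j + parityShift (v1 L)

/-! ### Both colours can be enumerated by the same index set -/

theorem even_baseX {L : AddSubgroup (ℤ × ℤ)} (hL : IsValidLattice L) : Even (baseX L) := by
  obtain ⟨v, w, rfl, -, hv, hw⟩ := hL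
  set L := AddSubgroup.closure {v, w} with hLdef
  have key : ∀ u ∈ L, Even (u.1 + u.2) := by
    intro u hu
    refine AddSubgroup.closure_induction (p := fun u _ => Even (u.1 + u.2)) ?_ ?_ ?_ ?_ hu
    · rintro x (rfl | rfl)
      · rcases hv with ⟨h1, h2⟩ | ⟨h1, h2⟩
        · exact h1.add h2
        · exact h1.add_odd h2
      · rcases hw with ⟨h1, h2⟩ | ⟨h1, h2⟩
        · exact h1.add h2
        · exact h1.add_odd h2
    · simp
    · intro x y _ _ hx hy
      have := hx.add hy
      rwa [add_add_add_comm] at this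
    · intro x _ hx
      have := hx.neg
      rwa [neg_add] at this
  rcases Set.eq_empty_or_nonempty {n : ℕ | 0 < n ∧ ((n : ℤ), (0 : ℤ)) ∈ L} with h | h
  · simp [baseX, h]
  · have := key _ (Nat.sInf_mem h).2
    simpa [baseX] using this

/-- Enumerations `b`, `w` as in the construction of the Kasteleyn matrix exist: the fundamental
domain has as many black squares as white squares. -/
theorem exists_enumerations {L : AddSubgroup (ℤ × ℤ)} (hL : IsValidLattice L) :
    ∃ n : ℕ, Nonempty (Fin n ≃ blackSquares L) ∧ Nonempty (Fin n ≃ whiteSquares L) := by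
  have hx : Even ((baseX L : ℕ) : ℤ) := by exact_mod_cast even_baseX hL
  have hfin : (domainSquares L).Finite := by
    refine ((Set.finite_Ico (0 : ℤ) (baseX L)).prod (Set.finite_Ico (0 : ℤ) (baseY L))).subset ?_
    rintro p ⟨h1, h2, h3, h4⟩
    exact ⟨⟨h1, h2⟩, ⟨h3, h4⟩⟩
  have hb : Finite (blackSquares L) := (hfin.subset fun p hp => hp.1).to_subtype
  let f : ℤ × ℤ → ℤ × ℤ := fun p => (if Even p.1 then p.1 + 1 else p.1 - 1, p.2)
  have hff : ∀ p, f (f p) = p := by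
    rintro ⟨x, y⟩
    by_cases h : Even x <;> simp [f, h, parity_simps]
  have hdom : ∀ p ∈ domainSquares L, f p ∈ domainSquares L := by
    rintro ⟨x, y⟩ ⟨h1, h2, h3, h4⟩
    obtain ⟨m, hm⟩ := hx
    by_cases h : Even x
    · obtain ⟨k, hk⟩ := id h
      simp only [f, h, if_true, domainSquares, Set.mem_ofPred_eq] at *
      omega
    · obtain ⟨k, hk⟩ := Int.not_even_iff_odd.1 h
      simp only [f, h, if_false, domainSquares, Set.mem_ofPred_eq] at *
      omega
  have hcol : ∀ p, Black (f p) ↔ ¬ Black p := by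
    rintro ⟨x, y⟩
    by_cases h : Even x
    · simp only [f, h, if_true, Black, Int.even_add, Int.not_even_one]
      tauto
    · simp only [f, h, if_false, Black, Int.even_add, Int.even_sub, Int.not_even_one]
      tauto
  let e : blackSquares L ≃ whiteSquares L :=
    { toFun := fun p => ⟨f p.1, hdom _ p.2.1, fun hc => (hcol _).1 hc p.2.2⟩
      invFun := fun p => ⟨f p.1, hdom _ p.2.1, (hcol _).2 p.2.2⟩
      left_inv := fun p => Subtype.ext (hff _)
      right_inv := fun p => Subtype.ext (hff _) }
  obtain ⟨n, ⟨g⟩⟩ := Finite.exists_equiv_fin (blackSquares L)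
  exact ⟨n, ⟨g.symm⟩, ⟨g.symm.trans e⟩⟩

end

end TorusDomino

/-! The weights separate into a monomial and a sign. Along a path the height changes by `±1` on each
edge, corrected by `±4` at each crossed domino. The corrections add up to four times the exponent,
and the `±1` cancel in pairs except for a remainder of `2` along `v1` when its coordinates are odd.
So `h (v_k)` is four times exponent plus `s_k`, and flux and monomial determine each other. Terms of
the full expansion correspond bijectively to tilings, so it remains to see that all tilings with one
flux have terms of the same sign; then nothing cancels in the coefficient.

The sign is `sgn σ` times `(-1)` to the number of black squares whose domino points in the brick
wall direction, times the constant `η ^ n`. If two tilings have the same flux, a quarter of their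
height difference is an integer function `g` on the vertices of the torus. Truncating `g` at level
one yields an intermediate tiling (`IsDifference.exists_truncation`), so by induction `g` may be
taken to be the indicator of a vertex set `χ`. In that case both factors of the sign change by `(-1)
^ |χ|`.

For the brick wall factor (`prod_mul_prod_eq_prod`): the sides of black squares in one fixed
direction have every vertex as an end point exactly once. For the permutation
(`sign_mul_sign_eq_prod`): rotating around white squares is rotating around black squares after
swapping the two sides that end at a vertex. Passing to first returns on the sides ending in `χ`
turns this into an identity of permutations whose defect is exactly `σ⁻¹ * σ'`
(`extendDomain_mul_whiteReturn`). The two returns have equal sign, and the swap has sign `(-1) ^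
|χ|`. This argument uses only the combinatorics of a checkerboard surface, isolated in
`CheckerboardMap`; `torusMap` is the instance for `ℝ² / L`. -/

namespace TorusDomino

open Equiv

/-! ### First-return maps on the four sides of a square -/

/-- The integer indicator of a Boolean. -/
def indicator (c : Bool) : ℤ := if c then 1 else 0

/-- Around a square with sides numbered by `Fin 4` in the direction of rotation `r`, the indicator
`χ` of the end points jumps up at the side `f'` and down at the side `f` (and is constant if
`f = f'`). -/
def JumpsAt (χ : Fin 4 → Bool) (r f f' : Fin 4) : Prop :=
  ∀ d, indicator (χ d) - indicator (χ (d - r)) =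
    (if f' = d then 1 else 0) - (if f = d then 1 else 0)

instance (χ : Fin 4 → Bool) (r f f' : Fin 4) : Decidable (JumpsAt χ r f f') :=
  inferInstanceAs (Decidable (∀ _, _))

/-- The first return of the rotation by `r` to the sides selected by `χ`. -/
def firstReturnFun (χ : Fin 4 → Bool) (r f' d : Fin 4) : Fin 4 :=
  if χ d then (if χ (d + r) then d + r else f') else d

/-- The selected sides form a cyclic interval that starts at `f'` and ends just before `f`, or all
sides, or none. So leaving the interval and re-entering at `f'` is a cycle. -/
theorem firstReturnFun_bijective (r : Fin 4) (hr : r = 1 ∨ r = 3) (f f' : Fin 4)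
    (χ : Fin 4 → Bool) (h : JumpsAt χ r f f') : Function.Bijective (firstReturnFun χ r f') := by
  rw [Function.Bijective, and_iff_left_of_imp Finite.surjective_of_injective]
  revert r f f' χ
  unfold Function.Injective
  decide +kernel

/-- A cycle on `k > 0` selected sides has sign `(-1) ^ (k - 1)`, and `f - r` is selected precisely
when `k > 0`. Quantifying over a permutation `κ` keeps the statement decidable, although
`firstReturn` is noncomputable. -/
theorem sign_of_eq_firstReturnFun (r : Fin 4) (hr : r = 1 ∨ r = 3) (f f' : Fin 4)
    (χ : Fin 4 → Bool) (h : JumpsAt χ r f f') (κ : Perm (Fin 4))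
    (hκ : ∀ d, κ d = firstReturnFun χ r f' d) :
    Perm.sign κ = (∏ d, if χ d then -1 else 1) * (if χ (f - r) then -1 else 1) := by
  revert r f f' χ κ
  decide +kernel

end TorusDomino

namespace TorusDomino

open Equiv

/-! ### Checkerboard maps on closed surfaces -/

/-- A decomposition of a closed surface into quadrilaterals with a checkerboard colouring, given
by its darts: `(i, d)` is the side of the `i`-th black square in direction `d`, and `toWhite (i, d)`
is the same side seen from the adjacent white square. The sides are oriented clockwise around black
squares, and `toVertex` records the final vertex of a side and which of the two incoming sides at
that vertex it is. -/
structure CheckerboardMap (ι V : Type*) where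
  toWhite : ι × Fin 4 ≃ ι × Fin 4
  toWhite_snd : ∀ x, (toWhite x).2 = x.2
  toVertex : ι × Fin 4 ≃ V × Bool
  -- The outgoing side that follows `x` around its white square is the one that follows the other
  -- incoming side around its black square.
  rotate : ∀ x, toWhite.symm ((toWhite x).1, x.2 + 1) =
    ((toVertex.symm ((toVertex x).1, !(toVertex x).2)).1,
      (toVertex.symm ((toVertex x).1, !(toVertex x).2)).2 + 3)
  -- The side `(i, d)` starts where `(i, d + 1)` ends. So the final and initial vertices of the
  -- sides in direction `d` exhaust the vertices without repetition.
  vertices : ∀ d, Function.Bijective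
    (Sum.elim (fun i => (toVertex (i, d)).1) (fun i => (toVertex (i, d + 1)).1))

namespace CheckerboardMap

variable {ι V : Type*} (M : CheckerboardMap ι V)

/-- The final vertex of a side. -/
def tgt (x : ι × Fin 4) : V := (M.toVertex x).1

/-- The other side with the same final vertex. -/
def other (x : ι × Fin 4) : ι × Fin 4 := M.toVertex.symm ((M.toVertex x).1, !(M.toVertex x).2)

/-- The directions `f` at the black squares form a perfect matching of black and white squares,
which joins the `i`-th black square to the `σ i`-th white square. -/
def IsMatching (f : ι → Fin 4) (σ : Perm ι) : Prop := ∀ i, M.toWhite (i, f i) = (σ i, f i)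

/-- The function `g` on the vertices is the height difference of the matchings `f` and `f'`. -/
def IsDifference (g : V → ℤ) (f f' : ι → Fin 4) : Prop :=
  ∀ i d, g (M.tgt (i, d)) - g (M.tgt (i, d + 1)) =
    (if f' i = d then 1 else 0) - (if f i = d then 1 else 0)

theorem tgt_other (x : ι × Fin 4) : M.tgt (M.other x) = M.tgt x := by
  simp [tgt, other]

theorem toWhite_symm_rotate (x : ι × Fin 4) :
    M.toWhite.symm ((M.toWhite x).1, x.2 + 1) = ((M.other x).1, (M.other x).2 + 3) :=
  M.rotate x

theorem toWhite_symm_snd (y : ι × Fin 4) : (M.toWhite.symm y).2 = y.2 := by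
  rw [← M.toWhite_snd, M.toWhite.apply_symm_apply]

/-- Both sides of the equation are the initial vertex of the side `(j, d)`, found by rotating around
its white or its black square. -/
theorem tgt_toWhite_symm_sub (j : ι) (d : Fin 4) :
    M.tgt (M.toWhite.symm (j, d - 1)) = M.tgt ((M.toWhite.symm (j, d)).1, d + 1) := by
  have h := M.toWhite_symm_rotate (M.toWhite.symm (j, d - 1))
  have hs := M.toWhite_symm_snd (j, d - 1)
  rw [M.toWhite.apply_symm_apply, hs] at h
  simp only [sub_add_cancel] at h
  rw [← M.tgt_other (M.toWhite.symm (j, d - 1)), h]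
  have h2 := M.toWhite_symm_snd (j, d)
  rw [h] at h2
  have h3 : ∀ k : Fin 4, k = k + 3 + 1 := by decide
  exact congrArg M.tgt (Prod.ext rfl ((h3 _).trans (congrArg (· + 1) h2)))

variable {M}

theorem IsMatching.eq_symm {f : ι → Fin 4} {σ : Perm ι} (h : M.IsMatching f σ) (i : ι) :
    M.toWhite.symm (σ i, f i) = (i, f i) := by
  rw [← h i, M.toWhite.symm_apply_apply]

theorem IsMatching.iff_white {f : ι → Fin 4} {σ : Perm ι} (h : M.IsMatching f σ) (j : ι)
    (d : Fin 4) : f (σ.symm j) = d ↔ f (M.toWhite.symm (j, d)).1 = d := by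
  constructor
  · rintro rfl
    have := h.eq_symm (σ.symm j)
    rw [σ.apply_symm_apply] at this
    rw [this]
  · intro h'
    have h1 := h (M.toWhite.symm (j, d)).1
    rw [h'] at h1
    have h2 : ((M.toWhite.symm (j, d)).1, d) = M.toWhite.symm (j, d) :=
      Prod.ext rfl (M.toWhite_symm_snd (j, d)).symm
    rw [h2, M.toWhite.apply_symm_apply] at h1
    have h3 : j = σ (M.toWhite.symm (j, d)).1 := (Prod.ext_iff.1 h1).1
    rw [(Equiv.symm_apply_eq σ).2 h3, h']

theorem IsMatching.perm_unique {f : ι → Fin 4} {σ τ : Perm ι} (h : M.IsMatching f σ)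
    (h' : M.IsMatching f τ) : σ = τ :=
  Equiv.ext fun i => (Prod.ext_iff.1 ((h i).symm.trans (h' i))).1

/-- The difference condition belongs to the sides, not to the colour from which they are seen, so it
can be read around white squares, where the rotation is reversed. -/
theorem IsDifference.white {g : V → ℤ} {f f' : ι → Fin 4} {σ σ' : Perm ι}
    (hd : M.IsDifference g f f') (h : M.IsMatching f σ) (h' : M.IsMatching f' σ') (j : ι)
    (d : Fin 4) :
    g (M.tgt (M.toWhite.symm (j, d))) - g (M.tgt (M.toWhite.symm (j, d - 1))) =
      (if f' (σ'.symm j) = d then 1 else 0) - (if f (σ.symm j) = d then 1 else 0) := by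
  rw [tgt_toWhite_symm_sub]
  have h2 : ((M.toWhite.symm (j, d)).1, d) = M.toWhite.symm (j, d) :=
    Prod.ext rfl (M.toWhite_symm_snd (j, d)).symm
  have := hd (M.toWhite.symm (j, d)).1 d
  rw [h2] at this
  rw [this]
  simp only [h.iff_white, h'.iff_white]

/-! ### The sign of the transition between two matchings that differ along a set of vertices -/

section Transition

variable {χ : V → Bool} {f f' : ι → Fin 4} {σ σ' : Perm ι}

theorem jumpsAt_black (hd : M.IsDifference (fun v => indicator (χ v)) f f') (i : ι) :
    JumpsAt (fun d => χ (M.tgt (i, d))) 3 (f i) (f' i) := by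
  intro d
  have : d - 3 = d + 1 := by revert d; decide
  rw [this]
  exact hd i d

theorem jumpsAt_white (hd : M.IsDifference (fun v => indicator (χ v)) f f')
    (h : M.IsMatching f σ) (h' : M.IsMatching f' σ') (j : ι) :
    JumpsAt (fun d => χ (M.tgt (M.toWhite.symm (j, d)))) 1 (f (σ.symm j)) (f' (σ'.symm j)) :=
  hd.white h h' j

/-- The first return of a rotation to the sides selected by `χ`. -/
noncomputable def firstReturn (χ : Fin 4 → Bool) (r : Fin 4) (hr : r = 1 ∨ r = 3) (f f' : Fin 4)
    (h : JumpsAt χ r f f') : Perm (Fin 4) :=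
  Equiv.ofBijective _ (firstReturnFun_bijective r hr f f' χ h)

/-- The first return of the clockwise rotation around black squares to the sides that end in
the set `χ`. -/
noncomputable def blackReturn (hd : M.IsDifference (fun v => indicator (χ v)) f f') :
    Perm (ι × Fin 4) :=
  prodCongrRight fun i => firstReturn _ 3 (.inr rfl) _ _ (jumpsAt_black hd i)

/-- The first return of the rotation around white squares to the sides that end in the set `χ`. -/
noncomputable def whiteReturn (hd : M.IsDifference (fun v => indicator (χ v)) f f')
    (h : M.IsMatching f σ) (h' : M.IsMatching f' σ') : Perm (ι × Fin 4) :=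
  M.toWhite.symm.permCongr <|
    prodCongrRight fun j => firstReturn _ 1 (.inl rfl) _ _ (jumpsAt_white hd h h' j)

variable (M χ) in
/-- The involution exchanging the two sides that end in any given vertex of `χ`. -/
def vertexSwap : Perm (ι × Fin 4) :=
  M.toVertex.symm.permCongr (prodCongrRight fun v => if χ v then Equiv.boolNot else 1)

theorem blackReturn_apply (hd : M.IsDifference (fun v => indicator (χ v)) f f')
    (x : ι × Fin 4) : blackReturn hd x =
      if χ (M.tgt x) then
        (if χ (M.tgt (x.1, x.2 + 3)) then (x.1, x.2 + 3) else (x.1, f' x.1)) else x := by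
  obtain ⟨i, d⟩ := x
  simp only [blackReturn, prodCongrRight_apply, firstReturn, ofBijective_apply, firstReturnFun]
  split_ifs <;> rfl

theorem whiteReturn_apply (hd : M.IsDifference (fun v => indicator (χ v)) f f')
    (h : M.IsMatching f σ) (h' : M.IsMatching f' σ') (x : ι × Fin 4) :
    whiteReturn hd h h' x =
      if χ (M.tgt x) then
        (if χ (M.tgt ((M.other x).1, (M.other x).2 + 3)) then
          ((M.other x).1, (M.other x).2 + 3) else
          (σ'.symm (M.toWhite x).1, f' (σ'.symm (M.toWhite x).1))) else x := by
  have h1 : M.toWhite x = ((M.toWhite x).1, x.2) := Prod.ext rfl (M.toWhite_snd x)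
  have h2 : M.toWhite.symm ((M.toWhite x).1, x.2) = x := by
    rw [← h1, M.toWhite.symm_apply_apply]
  have h3 : M.toWhite.symm ((M.toWhite x).1, f' (σ'.symm (M.toWhite x).1)) =
      (σ'.symm (M.toWhite x).1, f' (σ'.symm (M.toWhite x).1)) := by
    have := h'.eq_symm (σ'.symm (M.toWhite x).1)
    rwa [σ'.apply_symm_apply] at this
  rw [whiteReturn, permCongr_apply, symm_symm, h1]
  simp only [prodCongrRight_apply, firstReturn, ofBijective_apply, firstReturnFun]
  simp only [h2, toWhite_symm_rotate]
  split_ifs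
  · exact toWhite_symm_rotate _ x
  · exact h3
  · exact h2

theorem vertexSwap_apply (x : ι × Fin 4) :
    M.vertexSwap χ x = if χ (M.tgt x) then M.other x else x := by
  rw [vertexSwap, permCongr_apply, symm_symm]
  rcases hx : M.toVertex x with ⟨v, c⟩
  simp only [prodCongrRight_apply, tgt, hx, other]
  split_ifs
  · rfl
  · rw [Perm.one_apply, ← hx, M.toVertex.symm_apply_apply]

variable (f') in
/-- The black squares correspond to the sides in the matching `f'`. -/
def sideEquiv : ι ≃ {x : ι × Fin 4 // f' x.1 = x.2} where
  toFun i := ⟨(i, f' i), rfl⟩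
  invFun x := x.1.1
  left_inv _ := rfl
  right_inv x := Subtype.ext (Prod.ext rfl x.2)

/-- Without truncation to `χ` this would be the axiom `rotate`. First returns differ only where the
rotation leaves `χ`: there the two sides jump to the `f'`-side of the white and of the black square
of one `f`-domino, and `σ⁻¹ * σ'` carries the former to the latter. -/
theorem extendDomain_mul_whiteReturn [DecidableEq ι]
    (hd : M.IsDifference (fun v => indicator (χ v)) f f')
    (h : M.IsMatching f σ) (h' : M.IsMatching f' σ') :
    (σ⁻¹ * σ').extendDomain (sideEquiv f') * whiteReturn hd h h' =
      blackReturn hd * M.vertexSwap χ := by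
  have hext : ∀ x, (σ⁻¹ * σ').extendDomain (sideEquiv f') x =
      if f' x.1 = x.2 then ((σ⁻¹ * σ') x.1, f' ((σ⁻¹ * σ') x.1)) else x := by
    intro x
    split_ifs with hx
    · exact Perm.extendDomain_apply_subtype _ (sideEquiv f') hx
    · exact Perm.extendDomain_apply_not_subtype _ (sideEquiv f') hx
  have hfix : ∀ x : ι × Fin 4, f x.1 = x.2 → f' x.1 = x.2 → (σ⁻¹ * σ') x.1 = x.1 := by
    intro x h1 h2
    have a := h x.1
    have b := h' x.1
    rw [h1] at a
    rw [h2, a] at b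
    rw [Perm.mul_apply, Perm.inv_eq_iff_eq]
    exact (Prod.ext_iff.1 b).1.symm
  -- A side crossed by both matchings is not moved: both permutations send its black square to the
  -- white square across it.
  have hext' : ∀ x : ι × Fin 4, (f' x.1 = x.2 → f x.1 = x.2) →
      (σ⁻¹ * σ').extendDomain (sideEquiv f') x = x := by
    intro x hx
    rw [hext]
    split_ifs with h2
    · rw [hfix x (hx h2) h2, h2]
    · rfl
  refine Equiv.ext fun x => ?_
  rw [Perm.mul_apply, Perm.mul_apply, vertexSwap_apply, whiteReturn_apply]
  by_cases hx : χ (M.tgt x) = true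
  · rw [if_pos hx, if_pos hx, blackReturn_apply,
      if_pos (show χ (M.tgt (M.other x)) = true by rwa [tgt_other])]
    -- `y` is the common successor: it follows `x` around a white square and `other x` around a
    -- black one, and it starts in `χ`.
    set y : ι × Fin 4 := ((M.other x).1, (M.other x).2 + 3) with hy
    have hsrc : M.tgt (y.1, y.2 + 1) = M.tgt x := by
      rw [← M.tgt_other x]
      congr 1
      refine Prod.ext rfl ?_
      simp only [hy]
      generalize (M.other x).2 = k
      revert k
      decide
    have hjump := hd y.1 y.2
    rw [hsrc] at hjump
    simp only [hx, indicator, if_true] at hjump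
    by_cases hy' : χ (M.tgt y) = true
    · rw [if_pos hy', if_pos hy']
      refine hext' y fun h2 => ?_
      by_contra h3
      simp [hy', h2, h3] at hjump
    · rw [if_neg hy', if_neg hy']
      -- The indicator drops along `y`, so the domino of `f` must cross it.
      have h3 : f y.1 = y.2 := by
        by_contra h3
        simp only [hy', h3] at hjump
        split_ifs at hjump <;> simp_all
      have h4 : (M.toWhite x).1 = σ y.1 := by
        have a := h y.1
        rw [h3] at a
        have b := M.toWhite_symm_rotate x
        rw [← hy, Equiv.symm_apply_eq] at b
        exact (Prod.ext_iff.1 (b.trans a)).1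
      rw [hext, if_pos rfl, h4]
      simp [hy]
  · rw [if_neg hx, if_neg hx, blackReturn_apply, if_neg hx]
    refine hext' x fun h2 => ?_
    by_contra h3
    have hjump := hd x.1 x.2
    simp only [h2, h3, indicator, hx] at hjump
    split_ifs at hjump <;> simp_all

variable [Fintype ι] [DecidableEq ι]

theorem sign_blackReturn (hd : M.IsDifference (fun v => indicator (χ v)) f f') :
    Perm.sign (blackReturn hd) = (∏ x, if χ (M.tgt x) then -1 else 1) *
      ∏ i, (if χ (M.tgt (i, f i + 1)) then -1 else 1) := by
  rw [blackReturn, Perm.sign_prodCongrRight, Fintype.prod_prod_type, ← Finset.prod_mul_distrib]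
  refine Finset.prod_congr rfl fun i _ => ?_
  rw [sign_of_eq_firstReturnFun 3 (.inr rfl) _ _ _ (jumpsAt_black hd i) _ fun _ => rfl]
  have : f i - 3 = f i + 1 := by
    generalize f i = d
    revert d
    decide
  rw [this]

/-- The value agrees with `sign_blackReturn`: the correction is read at the initial vertex of the
side crossed by `f`, which is the same from both squares of the domino. -/
theorem sign_whiteReturn (hd : M.IsDifference (fun v => indicator (χ v)) f f')
    (h : M.IsMatching f σ) (h' : M.IsMatching f' σ') :
    Perm.sign (whiteReturn hd h h') = (∏ x, if χ (M.tgt x) then -1 else 1) *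
      ∏ i, (if χ (M.tgt (i, f i + 1)) then -1 else 1) := by
  rw [whiteReturn, Perm.sign_permCongr, Perm.sign_prodCongrRight]
  rw [Finset.prod_congr rfl fun j _ => sign_of_eq_firstReturnFun 1 (.inl rfl) _ _ _
    (jumpsAt_white hd h h' j) _ fun _ => rfl, Finset.prod_mul_distrib]
  congr 1
  · rw [← Fintype.prod_prod_type' fun j d =>
      (if χ (M.tgt (M.toWhite.symm (j, d))) then (-1 : ℤˣ) else 1)]
    exact Equiv.prod_comp M.toWhite.symm fun x => (if χ (M.tgt x) then (-1 : ℤˣ) else 1)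
  · rw [← Equiv.prod_comp σ]
    refine Finset.prod_congr rfl fun i _ => ?_
    rw [σ.symm_apply_apply, tgt_toWhite_symm_sub, h.eq_symm]

variable [Fintype V]

theorem sign_vertexSwap [DecidableEq V] : Perm.sign (M.vertexSwap χ) = ∏ v, if χ v then -1 else 1 := by
  rw [vertexSwap, Perm.sign_permCongr, Perm.sign_prodCongrRight]
  refine Finset.prod_congr rfl fun v _ => ?_
  split_ifs
  · decide
  · exact Perm.sign_one

/-- The transition between two matchings whose height difference is the indicator of a set of
vertices has the parity of the number of these vertices. -/
theorem sign_mul_sign_eq_prod [DecidableEq V]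
    (hd : M.IsDifference (fun v => indicator (χ v)) f f')
    (h : M.IsMatching f σ) (h' : M.IsMatching f' σ') :
    Perm.sign σ * Perm.sign σ' = ∏ v, if χ v then -1 else 1 := by
  have key := congrArg Perm.sign (extendDomain_mul_whiteReturn hd h h')
  rw [Perm.sign_mul, Perm.sign_mul, Perm.sign_extendDomain, sign_blackReturn, sign_whiteReturn,
    sign_vertexSwap, mul_comm, mul_right_inj] at key
  rw [← key, Perm.sign_mul, Perm.sign_inv]

omit [DecidableEq ι] in
-- Modulo 2, the number of the two matchings that cross a side is the sum of `χ` at its ends.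
-- Summing over the sides in direction `d` counts every vertex once.
theorem prod_mul_prod_eq_prod (hd : M.IsDifference (fun v => indicator (χ v)) f f') (d : Fin 4) :
    (∏ i, if f i = d then (-1 : ℤˣ) else 1) * (∏ i, if f' i = d then (-1 : ℤˣ) else 1) =
      ∏ v, if χ v then -1 else 1 := by
  rw [← Equiv.prod_comp (Equiv.ofBijective _ (M.vertices d)), Fintype.prod_sum_type,
    ← Finset.prod_mul_distrib, ← Finset.prod_mul_distrib]
  refine Finset.prod_congr rfl fun i _ => ?_
  have := hd i d
  simp only [indicator, tgt] at this
  simp only [ofBijective_apply, Sum.elim_inl, Sum.elim_inr]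
  split_ifs at this ⊢ <;> simp_all

end Transition

end CheckerboardMap
end TorusDomino

namespace TorusDomino

open Equiv

/-! ### Matchings with a common height difference have the same sign -/

/-- There is at most one upward jump, at `f'`, and one downward, at `f`, so the maximum is attained
at `f'` and only one lower value occurs. -/
theorem eq_or_eq_sub_one_of_jump (g : Fin 4 → ℤ) (r f f' : Fin 4) (hr : r = 1 ∨ r = 3)
    (h : ∀ d, g d - g (d - r) = (if f' = d then 1 else 0) - (if f = d then 1 else 0)) (d : Fin 4) :
    g d = g f' ∨ g d = g f' - 1 := by
  have h0 := h 0
  have h1 := h 1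
  have h2 := h 2
  have h3 := h 3
  clear h
  have e0 : (0 : Fin 4) - 3 = 1 := rfl
  have e1 : (0 : Fin 4) - 1 = 3 := rfl
  have e2 : (1 : Fin 4) - 3 = 2 := rfl
  have e3 : (2 : Fin 4) - 3 = 3 := rfl
  have e4 : (2 : Fin 4) - 1 = 1 := rfl
  have e5 : (3 : Fin 4) - 1 = 2 := rfl
  rcases hr with rfl | rfl <;>
    simp only [e0, e1, e2, e3, e4, e5, sub_self] at h0 h1 h2 h3 <;>
    generalize ha : g 0 = a at h0 h1 h2 h3 <;> generalize hb : g 1 = b at h0 h1 h2 h3 <;>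
    generalize hc : g 2 = c at h0 h1 h2 h3 <;> generalize he : g 3 = e at h0 h1 h2 h3 <;>
    obtain ⟨k, hk⟩ : ∃ k, k = g f' := ⟨_, rfl⟩ <;>
    rw [← hk] <;> fin_cases f <;> fin_cases f' <;>
    simp only [Fin.reduceFinMk, Fin.isValue, Fin.reduceEq, if_true, if_false, Fin.zero_eta,
      Fin.mk_one, ha, hb, hc, he] at h0 h1 h2 h3 hk <;>
    fin_cases d <;> simp only [Fin.reduceFinMk, Fin.isValue, Fin.zero_eta,
      Fin.mk_one, ha, hb, hc, he] <;> omega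

/-- With at most two adjacent values around the square, truncation at level one either reproduces
all jumps (`f₁ = f`) or removes them (`f₁ = f'`). -/
theorem exists_jump_of_truncation (g : Fin 4 → ℤ) (r f f' : Fin 4) (hr : r = 1 ∨ r = 3)
    (h : ∀ d, g d - g (d - r) = (if f' = d then 1 else 0) - (if f = d then 1 else 0)) :
    ∃ f₁, ∀ d, indicator (decide (1 ≤ g d)) - indicator (decide (1 ≤ g (d - r))) =
      (if f' = d then 1 else 0) - (if f₁ = d then 1 else 0) := by
  have key := eq_or_eq_sub_one_of_jump g r f f' hr h
  by_cases hg : g f' = 1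
  · have hind : ∀ d, indicator (decide (1 ≤ g d)) = g d := by
      intro d
      rcases key d with h1 | h1 <;> simp [indicator, h1, hg]
    exact ⟨f, fun d => by rw [hind, hind, h]⟩
  · have hind : ∀ d, indicator (decide (1 ≤ g d)) = indicator (decide (1 ≤ g f')) := by
      intro d
      have : 1 ≤ g d ↔ 1 ≤ g f' := by
        rcases key d with h1 | h1 <;> omega
      simp only [this]
    exact ⟨f', fun d => by rw [hind, hind (d - r), sub_self, sub_self]⟩

namespace CheckerboardMap

variable {ι V : Type*} {M : CheckerboardMap ι V} {f f' : ι → Fin 4} {σ σ' : Perm ι}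

/-- The intermediate matching is found separately at every black and every white square. -/
theorem IsDifference.exists_truncation {g : V → ℤ} (hd : M.IsDifference g f f')
    (h : M.IsMatching f σ) (h' : M.IsMatching f' σ') :
    ∃ f₁ σ₁, M.IsMatching f₁ σ₁ ∧
      M.IsDifference (fun v => indicator (decide (1 ≤ g v))) f₁ f' := by
  have hb : ∀ i, ∃ f₁ : Fin 4, ∀ d,
      indicator (decide (1 ≤ g (M.tgt (i, d)))) - indicator (decide (1 ≤ g (M.tgt (i, d + 1)))) =
      (if f' i = d then 1 else 0) - (if f₁ = d then 1 else 0) := by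
    intro i
    have h3 : ∀ d : Fin 4, d - 3 = d + 1 := by decide
    have := exists_jump_of_truncation (fun d => g (M.tgt (i, d))) 3 (f i) (f' i) (.inr rfl)
      (by simpa only [h3] using hd i)
    simpa only [h3] using this
  have hw := fun j => exists_jump_of_truncation (fun d => g (M.tgt (M.toWhite.symm (j, d)))) 1
      (f (σ.symm j)) (f' (σ'.symm j)) (.inl rfl) (hd.white h h' j)
  choose f₁ hf₁ using hb
  choose w₁ hw₁ using hw
  -- Whether the new domino crosses a side depends only on `f'` and the jump of the truncation along
  -- that side, so the black and the white choices agree.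
  have hcons : ∀ x : ι × Fin 4, f₁ x.1 = x.2 ↔ w₁ (M.toWhite x).1 = x.2 := by
    intro x
    have hx : ((M.toWhite x).1, x.2) = M.toWhite x := Prod.ext rfl (M.toWhite_snd x).symm
    have h1 := hf₁ x.1 x.2
    have h2 := hw₁ (M.toWhite x).1 x.2
    simp only [tgt_toWhite_symm_sub, h'.iff_white] at h2
    rw [hx, M.toWhite.symm_apply_apply] at h2
    rw [Prod.mk.eta] at h1
    rw [h1] at h2
    split_ifs at h2 <;> simp_all
  refine ⟨f₁, ⟨fun i => (M.toWhite (i, f₁ i)).1, fun j => (M.toWhite.symm (j, w₁ j)).1, ?_, ?_⟩,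
    ?_, hf₁⟩
  · intro i
    have h1 := (hcons (i, f₁ i)).1 rfl
    simp only at h1 ⊢
    have h2 : ((M.toWhite (i, f₁ i)).1, f₁ i) = M.toWhite (i, f₁ i) :=
      Prod.ext rfl (M.toWhite_snd (i, f₁ i)).symm
    rw [h1, h2, M.toWhite.symm_apply_apply]
  · intro j
    have h2 : ((M.toWhite.symm (j, w₁ j)).1, w₁ j) = M.toWhite.symm (j, w₁ j) :=
      Prod.ext rfl (M.toWhite_symm_snd (j, w₁ j)).symm
    have h1 := (hcons (M.toWhite.symm (j, w₁ j))).2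
      (by rw [M.toWhite.apply_symm_apply, M.toWhite_symm_snd])
    rw [M.toWhite_symm_snd] at h1
    simp only at h1 ⊢
    rw [h1, h2, M.toWhite.apply_symm_apply]
  · intro i
    exact Prod.ext rfl (M.toWhite_snd _)

variable [Fintype ι] [DecidableEq ι] [Fintype V] [DecidableEq V]

theorem sign_mul_prod_eq_of_indicator {χ : V → Bool}
    (hd : M.IsDifference (fun v => indicator (χ v)) f f') (h : M.IsMatching f σ)
    (h' : M.IsMatching f' σ') (d : Fin 4) :
    Perm.sign σ * (∏ i, if f i = d then (-1 : ℤˣ) else 1) =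
      Perm.sign σ' * (∏ i, if f' i = d then (-1 : ℤˣ) else 1) := by
  have key := sign_mul_sign_eq_prod hd h h'
  rw [← prod_mul_prod_eq_prod hd d] at key
  set A := ∏ i, if f i = d then (-1 : ℤˣ) else 1
  set B := ∏ i, if f' i = d then (-1 : ℤˣ) else 1
  calc Perm.sign σ * A = (Perm.sign σ * Perm.sign σ') * (Perm.sign σ' * A) := by
        rw [mul_assoc, ← mul_assoc (Perm.sign σ'), Int.units_mul_self, one_mul]
    _ = (A * A) * (Perm.sign σ' * B) := by rw [key]; ac_rfl
    _ = _ := by rw [Int.units_mul_self, one_mul]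

/-- Subtracting the indicator of `1 ≤ g` lowers the bound by one. The removed layer joins `f₁` to
`f'`; the rest joins `f` to `f₁`. -/
theorem sign_mul_prod_eq_of_le (d : Fin 4) (h : M.IsMatching f σ) (N : ℕ) (g : V → ℤ)
    (h0 : ∀ v, 0 ≤ g v) (h1 : ∀ v, g v ≤ N) (hd : M.IsDifference g f f')
    (h' : M.IsMatching f' σ') :
    Perm.sign σ * (∏ i, if f i = d then (-1 : ℤˣ) else 1) =
      Perm.sign σ' * (∏ i, if f' i = d then (-1 : ℤˣ) else 1) := by
  induction N generalizing g f' σ' with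
  | zero =>
    have hg : ∀ v, g v = 0 := fun v => le_antisymm (by simpa using h1 v) (h0 v)
    have hf : f = f' := by
      funext i
      have := hd i (f i)
      rw [hg, hg] at this
      split_ifs at this <;> simp_all
    subst hf
    rw [h.perm_unique h']
  | succ N ih =>
    obtain ⟨f₁, σ₁, hm, hd₁⟩ := hd.exists_truncation h h'
    rw [← sign_mul_prod_eq_of_indicator hd₁ hm h' d]
    refine ih (fun v => g v - indicator (decide (1 ≤ g v))) ?_ ?_ ?_ hm
    · intro v
      have := h0 v
      by_cases hv : 1 ≤ g v <;> simp [indicator, hv, this]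
    · intro v
      have := h1 v
      have := h0 v
      by_cases hv : 1 ≤ g v <;> simp [indicator, hv] <;> push_cast at * <;> omega
    · intro i d
      have a := hd i d
      have b := hd₁ i d
      linarith

/-- Two matchings with a global height difference have the same sign. -/
theorem IsDifference.sign_mul_prod_eq {g : V → ℤ} (hd : M.IsDifference g f f')
    (h : M.IsMatching f σ) (h' : M.IsMatching f' σ') (d : Fin 4) :
    Perm.sign σ * (∏ i, if f i = d then (-1 : ℤˣ) else 1) =
      Perm.sign σ' * (∏ i, if f' i = d then (-1 : ℤˣ) else 1) := by
  have hK : ∀ v, |g v| ≤ ∑ v, |g v| := fun v =>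
    Finset.single_le_sum (f := fun v => |g v|) (fun _ _ => abs_nonneg _) (Finset.mem_univ v)
  set K := ∑ v, |g v|
  have hK0 : 0 ≤ K := Finset.sum_nonneg fun _ _ => abs_nonneg _
  -- Only differences of `g` matter, so the shift by the bound `K` makes it lie between `0` and `2 *
  -- K`.
  refine sign_mul_prod_eq_of_le d h (2 * K).toNat (fun v => g v + K) ?_ ?_ ?_ h'
  · intro v
    linarith [neg_abs_le (g v), hK v]
  · intro v
    rw [Int.toNat_of_nonneg (by linarith)]
    linarith [le_abs_self (g v), hK v]
  · intro i d
    rw [← hd i d]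
    ring

end CheckerboardMap
end TorusDomino

namespace TorusDomino

/-! ### Valid lattices and their fundamental domains -/

section FundamentalDomain

variable {L : AddSubgroup (ℤ × ℤ)}

theorem eq_zero_of_mem_of_lt {x : ℤ} (h : (x, 0) ∈ L) (h0 : 0 ≤ x) (h1 : x < baseX L) : x = 0 := by
  by_contra hx
  have : baseX L ≤ x.toNat := Nat.sInf_le ⟨by omega, by rwa [Int.toNat_of_nonneg h0]⟩
  omega

theorem eq_zero_of_mem_of_lt' {x y : ℤ} (h : (x, y) ∈ L) (h0 : 0 ≤ y) (h1 : y < baseY L) :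
    y = 0 := by
  by_contra hy
  have : baseY L ≤ y.toNat := Nat.sInf_le ⟨by omega, x, by rwa [Int.toNat_of_nonneg h0]⟩
  omega

theorem eq_of_sub_mem {p q : ℤ × ℤ} (hp : p ∈ domainSquares L) (hq : q ∈ domainSquares L)
    (h : p - q ∈ L) : p = q := by
  obtain ⟨hp1, hp2, hp3, hp4⟩ := hp
  obtain ⟨hq1, hq2, hq3, hq4⟩ := hq
  have h' := neg_mem h
  rw [neg_sub] at h'
  have h2 : p.2 = q.2 := by
    rcases le_total q.2 p.2 with hle | hle
    · have := eq_zero_of_mem_of_lt' (x := p.1 - q.1) (y := p.2 - q.2) h (by omega) (by omega)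
      omega
    · have := eq_zero_of_mem_of_lt' (x := q.1 - p.1) (y := q.2 - p.2) h' (by omega) (by omega)
      omega
  have h3 : (p.1 - q.1, (0 : ℤ)) ∈ L := by
    convert h using 1
    ext <;> simp [h2]
  have h4 : (q.1 - p.1, (0 : ℤ)) ∈ L := by
    convert h' using 1
    ext <;> simp [h2]
  refine Prod.ext ?_ h2
  rcases le_total q.1 p.1 with hle | hle
  · have := eq_zero_of_mem_of_lt h3 (by omega) (by omega)
    omega
  · have := eq_zero_of_mem_of_lt h4 (by omega) (by omega)
    omega

variable {n : ℕ} (b : Fin n ≃ blackSquares L) (w : Fin n ≃ whiteSquares L)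

theorem black_index_unique {i j : Fin n} (h : (b i : ℤ × ℤ) - b j ∈ L) : i = j :=
  b.injective (Subtype.ext (eq_of_sub_mem (b i).2.1 (b j).2.1 h))

theorem white_index_unique {i j : Fin n} (h : (w i : ℤ × ℤ) - w j ∈ L) : i = j :=
  w.injective (Subtype.ext (eq_of_sub_mem (w i).2.1 (w j).2.1 h))

end FundamentalDomain

/-! ### Reduction of squares modulo a valid lattice -/

namespace IsValidLattice

variable {L : AddSubgroup (ℤ × ℤ)} (hL : IsValidLattice L)

include hL

theorem sameParity {u : ℤ × ℤ} (hu : u ∈ L) : Even u.1 ↔ Even u.2 := by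
  obtain ⟨v, w, rfl, -, hv, hw⟩ := hL
  have hp : ∀ u : ℤ × ℤ, SameParity u → (Even u.1 ↔ Even u.2) := by
    rintro u (⟨h1, h2⟩ | ⟨h1, h2⟩)
    · simp [h1, h2]
    · simp [Int.not_even_iff_odd.2 h1, Int.not_even_iff_odd.2 h2]
  refine AddSubgroup.closure_induction (p := fun u _ => (Even u.1 ↔ Even u.2)) ?_ ?_ ?_ ?_ hu
  · rintro x (rfl | rfl)
    exacts [hp _ hv, hp _ hw]
  · simp
  · intro x y _ _ hx hy
    simp [Int.even_add, hx, hy]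
  · intro x _ hx
    simpa using hx

/-- By Cramer's rule the determinant of the generators works. It shows that the sets in `baseX` and
`baseY` are nonempty, so that their infima are attained and not the default `0`. -/
theorem exists_det : ∃ D : ℤ, D ≠ 0 ∧ (D, 0) ∈ L ∧ (0, D) ∈ L := by
  obtain ⟨v, w, rfl, hD, -, -⟩ := hL
  have hv : v ∈ AddSubgroup.closure {v, w} := AddSubgroup.subset_closure (by simp)
  have hw : w ∈ AddSubgroup.closure {v, w} := AddSubgroup.subset_closure (by simp)
  refine ⟨_, hD, ?_, ?_⟩
  · convert sub_mem (zsmul_mem hv w.2) (zsmul_mem hw v.2) using 1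
    ext <;> simp <;> ring
  · convert sub_mem (zsmul_mem hw v.1) (zsmul_mem hv w.1) using 1
    ext <;> simp <;> ring

theorem baseX_spec : 0 < baseX L ∧ ((baseX L : ℤ), (0 : ℤ)) ∈ L := by
  obtain ⟨D, hD, h1, -⟩ := hL.exists_det
  refine Nat.sInf_mem (s := {n : ℕ | 0 < n ∧ ((n : ℤ), (0 : ℤ)) ∈ L})
    ⟨D.natAbs, Int.natAbs_pos.2 hD, ?_⟩
  rcases Int.natAbs_eq D with h | h
  · rwa [← h]
  · have := neg_mem h1
    rw [Prod.neg_mk, neg_zero] at this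
    rwa [show (D.natAbs : ℤ) = -D by omega]

theorem baseX_pos : 0 < (baseX L : ℤ) := by exact_mod_cast hL.baseX_spec.1

theorem v0_mem : v0 L ∈ L := hL.baseX_spec.2

theorem baseY_spec : 0 < baseY L ∧ ∃ x : ℤ, (x, (baseY L : ℤ)) ∈ L := by
  obtain ⟨D, hD, -, h1⟩ := hL.exists_det
  refine Nat.sInf_mem (s := {n : ℕ | 0 < n ∧ ∃ x : ℤ, (x, (n : ℤ)) ∈ L})
    ⟨D.natAbs, Int.natAbs_pos.2 hD, 0, ?_⟩
  rcases Int.natAbs_eq D with h | h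
  · rwa [← h]
  · have := neg_mem h1
    rw [Prod.neg_mk, neg_zero] at this
    rwa [show (D.natAbs : ℤ) = -D by omega]

theorem baseY_pos : 0 < (baseY L : ℤ) := by exact_mod_cast hL.baseY_spec.1

theorem add_zsmul_v0_mem {x y : ℤ} (h : (x, y) ∈ L) (k : ℤ) : (x + k * baseX L, y) ∈ L := by
  convert add_mem h (zsmul_mem hL.v0_mem k) using 1
  ext <;> simp [v0]

theorem v1_mem : v1 L ∈ L := by
  obtain ⟨-, x, hx⟩ := hL.baseY_spec
  have hne : {n : ℕ | n < baseX L ∧ ((n : ℤ), (baseY L : ℤ)) ∈ L}.Nonempty := by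
    refine ⟨(x % baseX L).toNat, ?_, ?_⟩
    · have := Int.emod_lt_of_pos x hL.baseX_pos
      have := Int.emod_nonneg x hL.baseX_pos.ne'
      omega
    · rw [Int.toNat_of_nonneg (Int.emod_nonneg x hL.baseX_pos.ne')]
      convert hL.add_zsmul_v0_mem hx (-(x / baseX L)) using 2
      rw [Int.emod_def]
      ring
  exact (Nat.sInf_mem hne).2

theorem exists_mem_domainSquares (p : ℤ × ℤ) : ∃ q ∈ domainSquares L, ∃ a b : ℤ,
    p = q + a • v0 L + b • v1 L := by
  have hx := hL.baseX_pos
  have hy := hL.baseY_pos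
  set b := p.2 / baseY L with hb
  set x := p.1 - b * shiftX L with hx'
  refine ⟨(x % baseX L, p.2 % baseY L), ⟨Int.emod_nonneg _ hx.ne', Int.emod_lt_of_pos _ hx,
    Int.emod_nonneg _ hy.ne', Int.emod_lt_of_pos _ hy⟩, x / baseX L, b, ?_⟩
  ext
  · have := Int.emod_add_mul_ediv x (baseX L)
    simp [v0, v1]
    linarith
  · have := Int.emod_add_mul_ediv p.2 (baseY L)
    simp [v0, v1]
    linarith

theorem exists_sub_mem (p : ℤ × ℤ) : ∃ q ∈ domainSquares L, p - q ∈ L := by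
  obtain ⟨q, hq, a, b, h⟩ := hL.exists_mem_domainSquares p
  refine ⟨q, hq, ?_⟩
  rw [h, add_assoc, add_sub_cancel_left]
  exact add_mem (zsmul_mem hL.v0_mem a) (zsmul_mem hL.v1_mem b)

theorem exists_eq_zsmul_add_zsmul {u : ℤ × ℤ} (hu : u ∈ L) :
    ∃ a b : ℤ, u = a • v0 L + b • v1 L := by
  obtain ⟨q, hq, a, b, h⟩ := hL.exists_mem_domainSquares u
  have hz : (0 : ℤ × ℤ) ∈ domainSquares L := ⟨le_rfl, hL.baseX_pos, le_rfl, hL.baseY_pos⟩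
  have hm : q - 0 ∈ L := by
    have : q - 0 = u - (a • v0 L + b • v1 L) := by
      rw [h]
      abel
    rw [this]
    exact sub_mem hu (add_mem (zsmul_mem hL.v0_mem a) (zsmul_mem hL.v1_mem b))
  rw [eq_of_sub_mem hq hz hm, zero_add] at h
  exact ⟨a, b, h⟩

theorem black_iff {p q : ℤ × ℤ} (h : p - q ∈ L) : Black p ↔ Black q := by
  have := hL.sameParity h
  simp only [Prod.fst_sub, Prod.snd_sub, Int.even_sub, Black, Int.even_add] at this ⊢
  tauto

theorem black_add_iff {u : ℤ × ℤ} (hu : u ∈ L) (p : ℤ × ℤ) : Black (p + u) ↔ Black p :=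
  hL.black_iff (by rwa [add_sub_cancel_left])

theorem finite_quotient : Finite ((ℤ × ℤ) ⧸ L) := by
  have hfin : (domainSquares L).Finite := by
    refine ((Set.finite_Ico (0 : ℤ) (baseX L)).prod (Set.finite_Ico (0 : ℤ) (baseY L))).subset ?_
    rintro p ⟨h1, h2, h3, h4⟩
    exact ⟨⟨h1, h2⟩, ⟨h3, h4⟩⟩
  have := hfin.to_subtype
  refine Finite.of_surjective (fun p : domainSquares L => (QuotientAddGroup.mk (p : ℤ × ℤ) :
    (ℤ × ℤ) ⧸ L)) ?_
  intro x
  obtain ⟨p, rfl⟩ := QuotientAddGroup.mk_surjective x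
  obtain ⟨q, hq, h⟩ := hL.exists_sub_mem p
  refine ⟨⟨q, hq⟩, ?_⟩
  rw [QuotientAddGroup.eq]
  convert h using 1
  abel

variable {n : ℕ} (b : Fin n ≃ blackSquares L) (w : Fin n ≃ whiteSquares L)

theorem exists_black_index {p : ℤ × ℤ} (hp : Black p) : ∃ i, p - (b i : ℤ × ℤ) ∈ L := by
  obtain ⟨q, hq, h⟩ := hL.exists_sub_mem p
  refine ⟨b.symm ⟨q, hq, (hL.black_iff h).1 hp⟩, ?_⟩
  rwa [b.apply_symm_apply]

theorem exists_white_index {p : ℤ × ℤ} (hp : ¬ Black p) : ∃ i, p - (w i : ℤ × ℤ) ∈ L := by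
  obtain ⟨q, hq, h⟩ := hL.exists_sub_mem p
  refine ⟨w.symm ⟨q, hq, fun hc => hp ((hL.black_iff h).2 hc)⟩, ?_⟩
  rwa [w.apply_symm_apply]

end IsValidLattice

end TorusDomino

namespace TorusDomino

open Equiv

/-! ### The checkerboard map of the torus -/

/-- The unit step in the direction `d`: right, up, left, down. -/
def step : Fin 4 → ℤ × ℤ := ![(1, 0), (0, 1), (-1, 0), (0, -1)]

/-- The final vertex, relative to the lower left corner, of the side in direction `d` of a square,
where the sides are oriented clockwise. -/
def corner : Fin 4 → ℤ × ℤ := ![(1, 0), (1, 1), (0, 1), (0, 0)]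

theorem black_add_step (p : ℤ × ℤ) (d : Fin 4) : Black (p + step d) ↔ ¬ Black p := by
  fin_cases d <;> simp [Black, step, Int.even_add, ← Int.not_even_iff_odd] <;> tauto

theorem black_add_corner (p : ℤ × ℤ) (d : Fin 4) :
    Black (p + corner d) ↔ (Black p ↔ (d = 1 ∨ d = 3)) := by
  fin_cases d <;> simp [Black, corner, Int.even_add, ← Int.not_even_iff_odd] <;> tauto

/-- The black squares diagonally opposite at a vertex share their white neighbours there; this is
what the field `rotate` needs. -/
theorem corner_sub_corner_add_step (d : Fin 4) :
    corner d - corner (d + 2) + step (d + 1) = step d := by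
  revert d
  decide

theorem mk_eq_mk_iff {L : AddSubgroup (ℤ × ℤ)} {p q : ℤ × ℤ} :
    (QuotientAddGroup.mk p : (ℤ × ℤ) ⧸ L) = QuotientAddGroup.mk q ↔ p - q ∈ L := by
  rw [eq_comm, QuotientAddGroup.eq, neg_add_eq_sub]

variable {L : AddSubgroup (ℤ × ℤ)} (hL : IsValidLattice L) {n : ℕ}
  (b : Fin n ≃ blackSquares L) (w : Fin n ≃ whiteSquares L)

include hL

theorem exists_whiteNeighbour (i : Fin n) (d : Fin 4) :
    ∃ j, (b i : ℤ × ℤ) + step d - w j ∈ L :=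
  hL.exists_white_index w (by rw [black_add_step]; exact not_not_intro (b i).2.2)

/-- The white square in direction `d` of the `i`-th black square. -/
noncomputable def whiteNeighbour (i : Fin n) (d : Fin 4) : Fin n :=
  (exists_whiteNeighbour hL b w i d).choose

theorem whiteNeighbour_spec (i : Fin n) (d : Fin 4) :
    (b i : ℤ × ℤ) + step d - w (whiteNeighbour hL b w i d) ∈ L :=
  (exists_whiteNeighbour hL b w i d).choose_spec

theorem whiteNeighbour_eq_iff {i j : Fin n} {d : Fin 4} :
    whiteNeighbour hL b w i d = j ↔ (b i : ℤ × ℤ) + step d - w j ∈ L := by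
  constructor
  · rintro rfl
    exact whiteNeighbour_spec hL b w i d
  · intro h
    refine white_index_unique w ?_
    have := sub_mem h (whiteNeighbour_spec hL b w i d)
    rwa [sub_sub_sub_cancel_left] at this

theorem whiteSide_bijective : Function.Bijective
    (fun x : Fin n × Fin 4 => (whiteNeighbour hL b w x.1 x.2, x.2)) := by
  refine Finite.injective_iff_bijective.1 ?_
  rintro ⟨i, d⟩ ⟨i', d'⟩ h
  simp only [Prod.mk.injEq] at h
  obtain ⟨h, rfl⟩ := h
  rw [whiteNeighbour_eq_iff] at h
  have := sub_mem h (whiteNeighbour_spec hL b w i' d)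
  rw [sub_sub_sub_cancel_right, add_sub_add_right_eq_sub] at this
  rw [black_index_unique b this]

/-- The colour of a vertex fixes the parity of the directions of the sides ending there; the Boolean
separates the two directions `d` and `d + 2` of that parity. -/
theorem vertexSide_bijective : Function.Bijective (fun x : Fin n × Fin 4 =>
    ((QuotientAddGroup.mk ((b x.1 : ℤ × ℤ) + corner x.2) : (ℤ × ℤ) ⧸ L), decide (x.2.val < 2))) := by
  constructor
  · rintro ⟨i, d⟩ ⟨i', d'⟩ h
    simp only [Prod.mk.injEq, mk_eq_mk_iff] at h
    obtain ⟨h, h2⟩ := h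
    have hp := hL.black_iff h
    rw [black_add_corner, black_add_corner, iff_true_left (b i).2.2,
      iff_true_left (b i').2.2] at hp
    have hdd : ∀ d d' : Fin 4, decide (d.val < 2) = decide (d'.val < 2) →
        ((d = 1 ∨ d = 3) ↔ (d' = 1 ∨ d' = 3)) → d = d' := by decide
    obtain rfl := hdd d d' h2 hp
    rw [add_sub_add_right_eq_sub] at h
    rw [black_index_unique b h]
  · rintro ⟨v, c⟩
    obtain ⟨p, rfl⟩ := QuotientAddGroup.mk_surjective v
    obtain ⟨d, hd, hc⟩ : ∃ d : Fin 4, (Black p ↔ (d = 1 ∨ d = 3)) ∧ decide (d.val < 2) = c := by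
      by_cases hp : Black p <;> cases c <;> simp only [hp, true_iff, false_iff] <;> decide
    have hb : Black (p - corner d) := by
      have := black_add_corner (p - corner d) d
      rw [sub_add_cancel] at this
      tauto
    obtain ⟨i, hi⟩ := hL.exists_black_index b hb
    refine ⟨(i, d), Prod.ext ?_ hc⟩
    rw [eq_comm, mk_eq_mk_iff, ← sub_sub]
    convert hi using 1
    abel

/-- Consecutive corners have opposite colours, so final and initial vertices cover one colour class
each. -/
theorem vertices_bijective (d : Fin 4) : Function.Bijective
    (Sum.elim (fun i => (QuotientAddGroup.mk ((b i : ℤ × ℤ) + corner d) : (ℤ × ℤ) ⧸ L))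
      (fun i => (QuotientAddGroup.mk ((b i : ℤ × ℤ) + corner (d + 1)) : (ℤ × ℤ) ⧸ L))) := by
  have hne : (d = 1 ∨ d = 3) ↔ ¬ (d + 1 = 1 ∨ d + 1 = 3) := by
    revert d
    decide
  constructor
  · rintro (i | i) (j | j) h
    · simp only [Sum.elim_inl, mk_eq_mk_iff, add_sub_add_right_eq_sub] at h
      rw [black_index_unique b h]
    · simp only [Sum.elim_inl, Sum.elim_inr, mk_eq_mk_iff] at h
      have hp := hL.black_iff h
      rw [black_add_corner, black_add_corner, iff_true_left (b i).2.2,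
        iff_true_left (b j).2.2] at hp
      tauto
    · simp only [Sum.elim_inl, Sum.elim_inr, mk_eq_mk_iff] at h
      have hp := hL.black_iff h
      rw [black_add_corner, black_add_corner, iff_true_left (b i).2.2,
        iff_true_left (b j).2.2] at hp
      tauto
    · simp only [Sum.elim_inr, mk_eq_mk_iff, add_sub_add_right_eq_sub] at h
      rw [black_index_unique b h]
  · intro v
    obtain ⟨p, rfl⟩ := QuotientAddGroup.mk_surjective v
    have key : ∀ d : Fin 4, (Black p ↔ (d = 1 ∨ d = 3)) →
        ∃ i, (QuotientAddGroup.mk ((b i : ℤ × ℤ) + corner d) : (ℤ × ℤ) ⧸ L) =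
          QuotientAddGroup.mk p := by
      intro d hd
      have hb : Black (p - corner d) := by
        have := black_add_corner (p - corner d) d
        rw [sub_add_cancel] at this
        tauto
      obtain ⟨i, hi⟩ := hL.exists_black_index b hb
      refine ⟨i, ?_⟩
      rw [eq_comm, mk_eq_mk_iff]
      convert hi using 1
      abel
    by_cases hp : Black p ↔ (d = 1 ∨ d = 3)
    · obtain ⟨i, hi⟩ := key d hp
      exact ⟨.inl i, hi⟩
    · obtain ⟨i, hi⟩ := key (d + 1) (by tauto)
      exact ⟨.inr i, hi⟩

/-- The checkerboard map of the torus `ℝ² / L`. -/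
noncomputable def torusMap : CheckerboardMap (Fin n) ((ℤ × ℤ) ⧸ L) where
  toWhite := Equiv.ofBijective _ (whiteSide_bijective hL b w)
  toWhite_snd _ := rfl
  toVertex := Equiv.ofBijective _ (vertexSide_bijective hL b)
  rotate := by
    rintro ⟨i, d⟩
    -- The other side ending at this vertex belongs to the diagonally opposite black square and has
    -- direction `d + 2`.
    have hb : Black ((b i : ℤ × ℤ) + corner d - corner (d + 2)) := by
      have := black_add_corner ((b i : ℤ × ℤ) + corner d - corner (d + 2)) (d + 2)
      rw [sub_add_cancel, black_add_corner, iff_true_left (b i).2.2] at this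
      have h2 : ∀ d : Fin 4, (d = 1 ∨ d = 3) ↔ (d + 2 = 1 ∨ d + 2 = 3) := by decide
      have := h2 d
      tauto
    obtain ⟨i', hi'⟩ := hL.exists_black_index b hb
    have hother : (Equiv.ofBijective _ (vertexSide_bijective hL b)).symm
        (((Equiv.ofBijective _ (vertexSide_bijective hL b)) (i, d)).1,
          !((Equiv.ofBijective _ (vertexSide_bijective hL b)) (i, d)).2) = (i', d + 2) := by
      rw [Equiv.symm_apply_eq]
      simp only [Equiv.ofBijective_apply]
      refine Prod.ext ?_ ?_
      · simp only [mk_eq_mk_iff]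
        convert hi' using 1
        abel
      · have h2 : ∀ d : Fin 4, (!decide (d.val < 2)) = decide ((d + 2).val < 2) := by decide
        exact h2 d
    rw [hother, Equiv.symm_apply_eq]
    simp only [Equiv.ofBijective_apply]
    have hd : d + 2 + 3 = d + 1 := by
      rw [add_assoc]
      rfl
    refine Prod.ext ?_ hd.symm
    simp only [hd]
    rw [eq_comm, whiteNeighbour_eq_iff]
    convert sub_mem (whiteNeighbour_spec hL b w i d) hi' using 1
    rw [← corner_sub_corner_add_step d]
    abel
  vertices := vertices_bijective hL b

end TorusDomino

namespace TorusDomino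

open scoped Classical

/-! ### Height functions -/

/-- The change of a height function of `t` along a grid edge. -/
noncomputable def heightJump (t : Set (Sym2 (ℤ × ℤ))) (e : GridEdge) : ℤ :=
  if e.crossed ∈ t then (if Black e.rightSquare then -3 else 3)
    else (if Black e.rightSquare then 1 else -1)

theorem grid_induction {P : ℤ × ℤ → Prop} (h0 : P 0)
    (h : ∀ e : GridEdge, P e.source ↔ P e.target) (v : ℤ × ℤ) : P v := by
  have hx : ∀ x : ℤ, P (x, 0) := by
    intro x
    induction x using Int.induction_on with
    | zero => exact h0
    | succ k hk => simpa [GridEdge.source, GridEdge.target] using (h (.right ((k : ℤ), 0))).1 hk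
    | pred k hk =>
      refine (h (.right (-(k : ℤ) - 1, 0))).2 ?_
      simpa [GridEdge.source, GridEdge.target] using hk
  obtain ⟨x, y⟩ := v
  induction y using Int.induction_on with
  | zero => exact hx x
  | succ k hk => simpa [GridEdge.source, GridEdge.target] using (h (.up (x, (k : ℤ)))).1 hk
  | pred k hk =>
    refine (h (.up (x, -(k : ℤ) - 1))).2 ?_
    simpa [GridEdge.source, GridEdge.target] using hk

theorem exists_primitive (g : ℤ → ℤ) : ∃ G : ℤ → ℤ, G 0 = 0 ∧ ∀ x, G (x + 1) - G x = g x := by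
  refine ⟨fun x => ∑ k ∈ Finset.Ico 0 x, g k - ∑ k ∈ Finset.Ico x 0, g k, by simp, fun x => ?_⟩
  beta_reduce
  rcases lt_or_ge x 0 with hx | hx
  · have h1 : Finset.Ico x 0 = insert x (Finset.Ico (x + 1) 0) := by
      ext k
      simp
      omega
    rw [h1, Finset.sum_insert (by simp), Finset.Ico_eq_empty_of_le (show x + 1 ≤ 0 by omega),
      Finset.Ico_eq_empty_of_le hx.le]
    ring
  · have h1 : Finset.Ico 0 (x + 1) = insert x (Finset.Ico 0 x) := by
      ext k
      simp
      omega
    rw [h1, Finset.sum_insert (by simp), Finset.Ico_eq_empty_of_le (show 0 ≤ x + 1 by omega),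
      Finset.Ico_eq_empty_of_le hx]
    ring

/-- A discrete Poincaré lemma: integrate along the horizontal axis and then vertically; closedness
around unit squares gives the horizontal jumps at every height. -/
theorem exists_potential (J : GridEdge → ℤ) (hJ : ∀ p, J (.right p) + J (.up (p + (1, 0))) =
    J (.up p) + J (.right (p + (0, 1)))) :
    ∃ h : ℤ × ℤ → ℤ, h 0 = 0 ∧ ∀ e : GridEdge, h e.target - h e.source = J e := by
  obtain ⟨A, hA0, hA⟩ := exists_primitive fun x => J (.right (x, 0))
  choose C hC0 hC using fun x : ℤ => exists_primitive fun y => J (.up (x, y))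
  have hright : ∀ x y : ℤ, A (x + 1) + C (x + 1) y - (A x + C x y) = J (.right (x, y)) := by
    intro x y
    have hstep : ∀ y : ℤ, (C (x + 1) (y + 1) - C (x + 1) y) - (C x (y + 1) - C x y) =
        J (.right (x, y + 1)) - J (.right (x, y)) := by
      intro y
      have := hJ (x, y)
      simp only [Prod.mk_add_mk, add_zero] at this
      rw [hC, hC]
      linarith
    induction y using Int.induction_on with
    | zero =>
      rw [hC0, hC0]
      linarith [hA x]
    | succ k hk => linarith [hstep k]
    | pred k hk =>
      have := hstep (-(k : ℤ) - 1)
      rw [sub_add_cancel] at this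
      linarith
  refine ⟨fun v => A v.1 + C v.1 v.2, by simp [hA0, hC0], ?_⟩
  rintro (⟨x, y⟩ | ⟨x, y⟩)
  · simpa [GridEdge.source, GridEdge.target] using hright x y
  · simpa [GridEdge.source, GridEdge.target] using hC x y

/-! ### Directions of dominoes and existence of height functions -/

theorem step_mem_unitSteps (d : Fin 4) : step d ∈ unitSteps := by
  revert d
  decide

theorem mem_unitSteps_iff {δ : ℤ × ℤ} : δ ∈ unitSteps ↔ ∃ d, step d = δ := by
  constructor
  · intro h
    simp only [unitSteps, Finset.mem_insert, Finset.mem_singleton] at h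
    rcases h with rfl | rfl | rfl | rfl
    exacts [⟨0, rfl⟩, ⟨1, rfl⟩, ⟨2, rfl⟩, ⟨3, rfl⟩]
  · rintro ⟨d, rfl⟩
    exact step_mem_unitSteps d

theorem step_injective : Function.Injective step := by
  unfold Function.Injective
  decide

theorem unitSteps_eq_image : unitSteps = Finset.univ.image step := by
  decide

theorem IsTiling.existsUnique_step {t : Set (Sym2 (ℤ × ℤ))} (ht : IsTiling t) (p : ℤ × ℤ) :
    ∃! d, s(p, p + step d) ∈ t := by
  obtain ⟨D, ⟨hD, hp⟩, huniq⟩ := ht.2 p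
  obtain ⟨q, rfl⟩ := Sym2.mem_iff_exists.1 hp
  have hq : ∃ d, q = p + step d := by
    obtain ⟨r, δ, hδ, h⟩ := ht.1 _ hD
    rcases Sym2.eq_iff.1 h with ⟨rfl, rfl⟩ | ⟨rfl, rfl⟩
    · obtain ⟨d, rfl⟩ := mem_unitSteps_iff.1 hδ
      exact ⟨d, rfl⟩
    · obtain ⟨d, rfl⟩ := mem_unitSteps_iff.1 hδ
      have : ∀ d, step d + step (d + 2) = 0 := by decide
      exact ⟨d + 2, by rw [add_assoc, this, add_zero]⟩
  obtain ⟨d, rfl⟩ := hq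
  refine ⟨d, hD, fun d' hd' => ?_⟩
  have := huniq _ ⟨hd', Sym2.mem_mk_left _ _⟩
  exact step_injective (add_left_cancel (Sym2.congr_right.1 this))

/-- Exactly one of the four sides of a square is crossed, so the jumps around it add up to `±(1 + 1
+ 1 - 3) = 0`. -/
theorem IsTiling.exists_heightFunction {t : Set (Sym2 (ℤ × ℤ))} (ht : IsTiling t) :
    ∃ h, IsHeightFunction t h := by
  refine exists_potential (heightJump t) fun p => ?_
  obtain ⟨d, hd, hu⟩ := ht.existsUnique_step p
  have h0 : (GridEdge.up (p + (1, 0))).crossed ∈ t ↔ d = 0 := by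
    have : (GridEdge.up (p + (1, 0))).crossed = s(p, p + step 0) := by
      simp [GridEdge.crossed, GridEdge.leftSquare, GridEdge.rightSquare, step]
    rw [this]
    exact ⟨fun h => (hu _ h).symm, fun h => h ▸ hd⟩
  have h1 : (GridEdge.right (p + (0, 1))).crossed ∈ t ↔ d = 1 := by
    have : (GridEdge.right (p + (0, 1))).crossed = s(p, p + step 1) := by
      simp [GridEdge.crossed, GridEdge.leftSquare, GridEdge.rightSquare, step, Sym2.eq_swap]
    rw [this]
    exact ⟨fun h => (hu _ h).symm, fun h => h ▸ hd⟩
  have h2 : (GridEdge.up p).crossed ∈ t ↔ d = 2 := by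
    have : (GridEdge.up p).crossed = s(p, p + step 2) := by
      rw [Sym2.eq_swap]
      congr 2
    rw [this]
    exact ⟨fun h => (hu _ h).symm, fun h => h ▸ hd⟩
  have h3 : (GridEdge.right p).crossed ∈ t ↔ d = 3 := by
    have : (GridEdge.right p).crossed = s(p, p + step 3) := rfl
    rw [this]
    exact ⟨fun h => (hu _ h).symm, fun h => h ▸ hd⟩
  have b0 : Black (GridEdge.up (p + (1, 0))).rightSquare ↔ ¬ Black p := black_add_step p 0
  have b1 : Black (GridEdge.right (p + (0, 1))).rightSquare ↔ Black p := by
    simp [GridEdge.rightSquare]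
  have b2 : Black (GridEdge.up p).rightSquare ↔ Black p := Iff.rfl
  have b3 : Black (GridEdge.right p).rightSquare ↔ ¬ Black p := black_add_step p 3
  simp only [heightJump, h0, h1, h2, h3, b0, b1, b2, b3]
  by_cases hp : Black p <;> fin_cases d <;> simp [hp]

/-- The change of the height along a side of a black square, in clockwise direction. -/
theorem IsHeightFunction.jump_black {t : Set (Sym2 (ℤ × ℤ))} {h : ℤ × ℤ → ℤ}
    (hh : IsHeightFunction t h) {p : ℤ × ℤ} (hp : Black p) (d : Fin 4) :
    h (p + corner d) - h (p + corner (d + 1)) = if s(p, p + step d) ∈ t then -3 else 1 := by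
  fin_cases d
  · have := hh.2 (.up (p + (1, 0)))
    have b0 : ¬ Black (GridEdge.up (p + (1, 0))).rightSquare :=
      fun hc => (black_add_step p 0).1 hc hp
    have e : (GridEdge.up (p + (1, 0))).crossed = s(p, p + step 0) := by
      simp [GridEdge.crossed, GridEdge.leftSquare, GridEdge.rightSquare, step]
    simp only [b0, if_false, e] at this
    have hs : p + (1, 0) + (0, 1) = p + (1, 1) := by
      rw [add_assoc]
      rfl
    simp only [GridEdge.source, GridEdge.target, hs] at this
    change h (p + (1, 0)) - h (p + (1, 1)) = if s(p, p + step 0) ∈ t then -3 else 1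
    split_ifs at this ⊢ <;> omega
  · have := hh.2 (.right (p + (0, 1)))
    have b1 : Black (GridEdge.right (p + (0, 1))).rightSquare := by
      simpa [GridEdge.rightSquare] using hp
    have e : (GridEdge.right (p + (0, 1))).crossed = s(p, p + step 1) := by
      simp [GridEdge.crossed, GridEdge.leftSquare, GridEdge.rightSquare, step, Sym2.eq_swap]
    simp only [b1, if_true, e] at this
    simpa [GridEdge.source, GridEdge.target, corner, add_assoc] using this
  · have := hh.2 (.up p)
    have e : (GridEdge.up p).crossed = s(p, p + step 2) := by
      rw [Sym2.eq_swap]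
      congr 2
    have b2 : Black (GridEdge.up p).rightSquare := hp
    simp only [b2, if_true, e] at this
    simp only [GridEdge.source, GridEdge.target] at this
    change h (p + (0, 1)) - h (p + 0) = if s(p, p + step 2) ∈ t then -3 else 1
    rwa [add_zero]
  · have := hh.2 (.right p)
    have b0 : ¬ Black (GridEdge.right p).rightSquare := fun hc => (black_add_step p 3).1 hc hp
    have e : (GridEdge.right p).crossed = s(p, p + step 3) := rfl
    simp only [b0, if_false, e] at this
    simp only [GridEdge.source, GridEdge.target] at this
    change h (p + 0) - h (p + (1, 0)) = if s(p, p + step 3) ∈ t then -3 else 1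
    rw [add_zero]
    split_ifs at this ⊢ <;> omega

end TorusDomino

namespace TorusDomino

open Equiv
open scoped Classical

/-! ### Periodicity -/

/-- The translate of a grid edge. -/
def GridEdge.shift (u : ℤ × ℤ) : GridEdge → GridEdge
  | right v => right (v + u)
  | up v => up (v + u)

theorem GridEdge.source_shift (u : ℤ × ℤ) (e : GridEdge) :
    (e.shift u).source = e.source + u := by
  cases e <;> rfl

theorem GridEdge.target_shift (u : ℤ × ℤ) (e : GridEdge) :
    (e.shift u).target = e.target + u := by
  cases e <;> exact add_right_comm _ _ _

theorem GridEdge.rightSquare_shift (u : ℤ × ℤ) (e : GridEdge) :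
    (e.shift u).rightSquare = e.rightSquare + u := by
  cases e
  · exact (sub_add_eq_add_sub _ _ _).symm
  · rfl

theorem GridEdge.leftSquare_shift (u : ℤ × ℤ) (e : GridEdge) :
    (e.shift u).leftSquare = e.leftSquare + u := by
  cases e
  · rfl
  · exact (sub_add_eq_add_sub _ _ _).symm

theorem GridEdge.crossed_shift (u : ℤ × ℤ) (e : GridEdge) :
    (e.shift u).crossed = translate u e.crossed := by
  simp [crossed, leftSquare_shift, rightSquare_shift, translate]

theorem translate_translate (u v : ℤ × ℤ) (d : Sym2 (ℤ × ℤ)) :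
    translate u (translate v d) = translate (v + u) d := by
  simp [translate, Sym2.map_map, add_assoc]

theorem translate_zero (d : Sym2 (ℤ × ℤ)) : translate 0 d = d := by
  simp [translate]

theorem translate_mk (u p q : ℤ × ℤ) : translate u s(p, q) = s(p + u, q + u) := rfl

variable {L : AddSubgroup (ℤ × ℤ)} {t t' : Set (Sym2 (ℤ × ℤ))}

theorem translate_mem_iff (ht : t ∈ torusTilings L) {u : ℤ × ℤ} (hu : u ∈ L)
    (d : Sym2 (ℤ × ℤ)) : translate u d ∈ t ↔ d ∈ t := by
  refine ⟨fun h => ?_, ht.2 u hu d⟩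
  have := ht.2 (-u) (neg_mem hu) _ h
  rwa [translate_translate, add_neg_cancel, translate_zero] at this

/-- `h` and its translate have equal jumps, since translation by `L` preserves tiling and colours;
hence they differ by a constant. -/
theorem IsHeightFunction.add_of_mem (hL : IsValidLattice L) (ht : t ∈ torusTilings L)
    {h : ℤ × ℤ → ℤ} (hh : IsHeightFunction t h) (v : ℤ × ℤ) {u : ℤ × ℤ} (hu : u ∈ L) :
    h (v + u) = h v + h u := by
  refine grid_induction (P := fun v => h (v + u) = h v + h u) ?_ (fun e => ?_) v
  · rw [zero_add, hh.1, zero_add]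
  · have h1 := hh.2 e
    have h2 := hh.2 (e.shift u)
    rw [e.crossed_shift, translate_mem_iff ht hu, e.rightSquare_shift, hL.black_add_iff hu,
      e.source_shift, e.target_shift, ← h1] at h2
    constructor <;> intro <;> linarith

theorem IsHeightFunction.hasFlux (hL : IsValidLattice L) (ht : t ∈ torusTilings L)
    {h : ℤ × ℤ → ℤ} (hh : IsHeightFunction t h) {φ : ℝ × ℝ}
    (h0 : (h (v0 L) : ℝ) = 4 * pairing φ (v0 L)) (h1 : (h (v1 L) : ℝ) = 4 * pairing φ (v1 L)) :
    HasFlux L t φ := by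
  refine ⟨h, hh, fun v u hu => ?_⟩
  rw [hh.add_of_mem hL ht v hu, add_sub_cancel_left]
  let H : L →+ ℤ := AddMonoidHom.mk' (fun u => h u) fun u v => hh.add_of_mem hL ht _ v.2
  obtain ⟨a, b, hab⟩ := hL.exists_eq_zsmul_add_zsmul hu
  have hH : H ⟨u, hu⟩ = a * h (v0 L) + b * h (v1 L) := by
    have : (⟨u, hu⟩ : L) = a • ⟨v0 L, hL.v0_mem⟩ + b • ⟨v1 L, hL.v1_mem⟩ := Subtype.ext hab
    rw [this, map_add, map_zsmul, map_zsmul, smul_eq_mul, smul_eq_mul]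
    rfl
  change ((H ⟨u, hu⟩ : ℤ) : ℝ) = _
  rw [hH, hab]
  push_cast
  rw [h0, h1]
  simp only [pairing, Prod.fst_add, Prod.snd_add, Prod.smul_fst, Prod.smul_snd, smul_eq_mul]
  push_cast
  ring

/-! ### The height along the two paths -/

/-- The signed number of dominoes of `t` crossed by the edge-path `γ`. -/
noncomputable def signedCrossings (t : Set (Sym2 (ℤ × ℤ))) (γ : List GridEdge) : ℤ :=
  (γ.map fun e => if e.crossed ∈ t then (if Black e.rightSquare then (-1 : ℤ) else 1) else 0).sum

theorem signedCrossings_append (γ γ' : List GridEdge) :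
    signedCrossings t (γ ++ γ') = signedCrossings t γ + signedCrossings t γ' := by
  simp [signedCrossings]

theorem IsHeightFunction.jump_eq {h : ℤ × ℤ → ℤ} (hh : IsHeightFunction t h) (e : GridEdge) :
    h e.target - h e.source = 4 * signedCrossings t [e] + if Black e.rightSquare then 1 else -1 := by
  rw [hh.2, signedCrossings, List.map_singleton, List.sum_singleton]
  split_ifs <;> norm_num

/-- The ranges in the path definitions are coerced to lists of integers; indexing by naturals
prepares for induction on the length. -/
theorem path0_eq : path0 L = (List.range (baseX L)).map fun k : ℕ => GridEdge.right ((k : ℤ), 0) := by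
  simp [path0, List.bind_eq_flatMap, ← List.map_eq_flatMap]

theorem path1_eq : path1 L =
    ((List.range (baseY L)).map fun k : ℕ => GridEdge.up (0, (k : ℤ))) ++
      (List.range (shiftX L)).map fun k : ℕ => GridEdge.right ((k : ℤ), (baseY L : ℤ)) := by
  simp [path1, List.bind_eq_flatMap, ← List.map_eq_flatMap, Function.comp_def]

/-- The colours along a line alternate, so the jumps `±1` of the uncrossed rule cancel in pairs and
at most the first one is left. -/
theorem IsHeightFunction.horizontal {h : ℤ × ℤ → ℤ} (hh : IsHeightFunction t h) (y : ℤ) (N : ℕ) :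
    h (N, y) - h (0, y) =
      4 * signedCrossings t ((List.range N).map fun k : ℕ => GridEdge.right ((k : ℤ), y)) +
        if Even N then 0 else if Even y then -1 else 1 := by
  induction N with
  | zero => simp [signedCrossings]
  | succ N ih =>
    have := hh.jump_eq (.right ((N : ℤ), y))
    rw [List.range_succ, List.map_append, List.map_singleton, signedCrossings_append]
    simp only [GridEdge.source, GridEdge.target, GridEdge.rightSquare, Black, Prod.mk_add_mk,
      add_zero, Prod.mk_sub_mk, sub_zero, Int.even_add, Int.even_sub, Int.even_coe_nat,
      Int.not_even_one, iff_false] at this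
    simp only [Nat.even_add_one]
    push_cast
    by_cases hN : Even N <;> by_cases hy : Even y <;>
      simp only [hN, hy, if_true, if_false, not_true_eq_false, not_false_eq_true, iff_true,
        iff_false] at this ih ⊢ <;> linarith

theorem IsHeightFunction.vertical {h : ℤ × ℤ → ℤ} (hh : IsHeightFunction t h) (N : ℕ) :
    h (0, N) =
      4 * signedCrossings t ((List.range N).map fun k : ℕ => GridEdge.up (0, (k : ℤ))) +
        if Even N then 0 else 1 := by
  induction N with
  | zero => simp [signedCrossings, show h (0, 0) = 0 from hh.1]
  | succ N ih =>
    have := hh.jump_eq (.up (0, (N : ℤ)))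
    rw [List.range_succ, List.map_append, List.map_singleton, signedCrossings_append]
    simp only [GridEdge.source, GridEdge.target, GridEdge.rightSquare, Black, Prod.mk_add_mk,
      add_zero, zero_add, Int.even_coe_nat] at this
    simp only [Nat.even_add_one]
    push_cast
    by_cases hN : Even N <;>
      simp only [hN, if_true, if_false, not_true_eq_false, not_false_eq_true] at this ih ⊢ <;>
      linarith

theorem IsHeightFunction.apply_v0 (hL : IsValidLattice L) {h : ℤ × ℤ → ℤ}
    (hh : IsHeightFunction t h) :
    (h (v0 L) : ℝ) = 4 * (signedCrossings t (path0 L) + parityShift (v0 L)) := by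
  have h0 := hh.horizontal 0 (baseX L)
  have he : Even (baseX L) := even_baseX hL
  have hz : h (0, 0) = 0 := hh.1
  rw [if_pos he, hz, sub_zero, add_zero, ← path0_eq] at h0
  have hs : parityShift (v0 L) = 0 := if_pos ((Int.even_coe_nat _).2 he)
  rw [hs, add_zero]
  exact_mod_cast h0

/-- If the coordinates are odd, each leg of the path leaves a remainder `1`; together `2 = 4 * (1 /
2)`, whence the shift. -/
theorem IsHeightFunction.apply_v1 (hL : IsValidLattice L) {h : ℤ × ℤ → ℤ}
    (hh : IsHeightFunction t h) :
    (h (v1 L) : ℝ) = 4 * (signedCrossings t (path1 L) + parityShift (v1 L)) := by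
  have h0 := hh.horizontal (baseY L) (shiftX L)
  have h1 := hh.vertical (baseY L)
  have hp : Even (shiftX L) ↔ Even (baseY L) := by
    have := hL.sameParity hL.v1_mem
    simpa only [v1, Int.even_coe_nat] using this
  rw [path1_eq, signedCrossings_append]
  set A := signedCrossings t ((List.range (baseY L)).map fun k : ℕ => GridEdge.up (0, (k : ℤ)))
  set B := signedCrossings t
    ((List.range (shiftX L)).map fun k : ℕ => GridEdge.right ((k : ℤ), (baseY L : ℤ)))
  simp only [h1, Int.even_coe_nat] at h0
  by_cases he : Even (shiftX L)
  · have hs : parityShift (v1 L) = 0 := if_pos ((Int.even_coe_nat _).2 he)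
    rw [if_pos he, if_pos (hp.1 he)] at h0
    have h2 : h (v1 L) = 4 * (A + B) := by
      change h (_, _) = _
      linarith
    rw [hs, h2]
    push_cast
    ring
  · have hs : parityShift (v1 L) = 1 / 2 := if_neg (mt (Int.even_coe_nat _).1 he)
    rw [if_neg he, if_neg (mt hp.2 he), if_neg (mt hp.2 he)] at h0
    have h2 : h (v1 L) = 4 * (A + B) + 2 := by
      change h (_, _) = _
      linarith
    rw [hs, h2]
    push_cast
    ring

theorem correspondsToFlux_of_mem (hL : IsValidLattice L) {φ : ℝ × ℝ}
    (ht : t ∈ tilingsWithFlux L φ) :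
    CorrespondsToFlux L φ (signedCrossings t (path0 L)) (signedCrossings t (path1 L)) := by
  obtain ⟨-, h, hh, hφ⟩ := ht
  have h0 := hφ 0 _ hL.v0_mem
  have h1 := hφ 0 _ hL.v1_mem
  rw [zero_add, hh.1, sub_zero] at h0 h1
  rw [hh.apply_v0 hL] at h0
  rw [hh.apply_v1 hL] at h1
  constructor <;> linarith

theorem mem_tilingsWithFlux_of_correspondsToFlux (hL : IsValidLattice L) {φ : ℝ × ℝ}
    (ht : t ∈ torusTilings L)
    (hc : CorrespondsToFlux L φ (signedCrossings t (path0 L)) (signedCrossings t (path1 L))) :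
    t ∈ tilingsWithFlux L φ := by
  obtain ⟨h, hh⟩ := ht.1.exists_heightFunction
  refine ⟨ht, hh.hasFlux hL ht ?_ ?_⟩
  · rw [hc.1, hh.apply_v0 hL]
  · rw [hc.2, hh.apply_v1 hL]

/-- The flux determines the exponents. -/
theorem CorrespondsToFlux.unique {φ : ℝ × ℝ} {i j i' j' : ℤ} (h : CorrespondsToFlux L φ i j)
    (h' : CorrespondsToFlux L φ i' j') : i = i' ∧ j = j' := by
  have h0 := h.1.symm.trans h'.1
  have h1 := h.2.symm.trans h'.2
  exact ⟨by exact_mod_cast add_right_cancel h0, by exact_mod_cast add_right_cancel h1⟩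

end TorusDomino

namespace TorusDomino

open Equiv
open scoped Classical

/-! ### Tilings of the torus and perfect matchings -/

variable {L : AddSubgroup (ℤ × ℤ)} (hL : IsValidLattice L) {n : ℕ}
  (b : Fin n ≃ blackSquares L) (w : Fin n ≃ whiteSquares L)

/-- The tiling `t` has the domino in direction `f i` on the `i`-th black square. -/
def HasDirections (t : Set (Sym2 (ℤ × ℤ))) (f : Fin n → Fin 4) : Prop :=
  ∀ i d, s((b i : ℤ × ℤ), (b i : ℤ × ℤ) + step d) ∈ t ↔ f i = d

/-- The periodic set of dominoes with direction `f i` on the translates of the `i`-th black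
square. -/
def tilingOf (f : Fin n → Fin 4) : Set (Sym2 (ℤ × ℤ)) :=
  {d | ∃ i, ∃ u ∈ L, d = translate u s((b i : ℤ × ℤ), (b i : ℤ × ℤ) + step (f i))}

theorem isMatching_iff {f : Fin n → Fin 4} {σ : Perm (Fin n)} :
    (torusMap hL b w).IsMatching f σ ↔
      ∀ i, (b i : ℤ × ℤ) + step (f i) - w (σ i) ∈ L := by
  refine forall_congr' fun i => ?_
  rw [← whiteNeighbour_eq_iff hL b w]
  exact ⟨fun h => (Prod.ext_iff.1 h).1, fun h => Prod.ext h rfl⟩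

theorem exists_black_translate {p : ℤ × ℤ} (hL : IsValidLattice L) (hp : Black p) :
    ∃ i, ∃ u ∈ L, p = (b i : ℤ × ℤ) + u := by
  obtain ⟨i, hi⟩ := hL.exists_black_index b hp
  exact ⟨i, _, hi, (add_sub_cancel _ _).symm⟩

/-- Dominoes are determined by the black square and the direction. -/
theorem domino_eq_iff {p q : ℤ × ℤ} (hp : Black p) (hq : Black q) {d e : Fin 4} :
    s(p, p + step d) = s(q, q + step e) ↔ p = q ∧ d = e := by
  constructor
  · intro h
    rcases Sym2.eq_iff.1 h with ⟨rfl, h2⟩ | ⟨h1, -⟩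
    · exact ⟨rfl, step_injective (add_left_cancel h2)⟩
    · rw [h1, black_add_step] at hp
      exact absurd hq hp
  · rintro ⟨rfl, rfl⟩
    rfl

theorem translate_domino (u p : ℤ × ℤ) (d : Fin 4) :
    translate u s(p, p + step d) = s(p + u, p + u + step d) := by
  rw [translate_mk, add_right_comm]

include hL

theorem hasDirections_tilingOf (f : Fin n → Fin 4) : HasDirections b (tilingOf b f) f := by
  intro i d
  constructor
  · rintro ⟨i', u, hu, h⟩
    rw [translate_domino, domino_eq_iff (b i).2.2 ((hL.black_add_iff hu _).2 (b i').2.2)] at h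
    obtain ⟨h, rfl⟩ := h
    rw [black_index_unique b (i := i) (j := i') (by rwa [h, add_sub_cancel_left])]
  · rintro rfl
    exact ⟨i, 0, zero_mem L, (translate_zero _).symm⟩

theorem tilingOf_mem_torusTilings {f : Fin n → Fin 4} {σ : Perm (Fin n)}
    (h : (torusMap hL b w).IsMatching f σ) : tilingOf b f ∈ torusTilings L := by
  rw [isMatching_iff] at h
  refine ⟨⟨?_, ?_⟩, ?_⟩
  · rintro d ⟨i, u, -, rfl⟩
    exact ⟨(b i : ℤ × ℤ) + u, step (f i), step_mem_unitSteps _, translate_domino _ _ _⟩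
  · intro p
    by_cases hp : Black p
    · obtain ⟨i, u, hu, rfl⟩ := exists_black_translate b hL hp
      refine ⟨_, ⟨⟨i, u, hu, rfl⟩, ?_⟩, ?_⟩
      · rw [translate_mk]
        exact Sym2.mem_mk_left _ _
      · rintro _ ⟨⟨i', u', hu', rfl⟩, hmem⟩
        rw [translate_domino] at hmem ⊢
        rw [translate_domino]
        have hb : Black ((b i' : ℤ × ℤ) + u') := (hL.black_add_iff hu' _).2 (b i').2.2
        rcases Sym2.mem_iff.1 hmem with h1 | h1
        · have : i = i' := black_index_unique b <| by
            have : (b i : ℤ × ℤ) - b i' = u' - u := by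
              rw [sub_eq_sub_iff_add_eq_add, h1, add_comm]
            rw [this]
            exact sub_mem hu' hu
          subst this
          rw [h1]
        · rw [h1, black_add_step] at hp
          exact absurd hb hp
    · obtain ⟨j, hj⟩ := hL.exists_white_index w hp
      obtain ⟨i, rfl⟩ := σ.surjective j
      set u := p - ((b i : ℤ × ℤ) + step (f i)) with hu
      have huL : u ∈ L := by
        have := sub_mem hj (h i)
        rwa [sub_sub_sub_cancel_right] at this
      have hpu : p = (b i : ℤ × ℤ) + u + step (f i) := by
        rw [hu]
        abel
      refine ⟨_, ⟨⟨i, u, huL, rfl⟩, ?_⟩, ?_⟩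
      · rw [translate_domino, ← hpu]
        exact Sym2.mem_mk_right _ _
      · rintro _ ⟨⟨i', u', hu', rfl⟩, hmem⟩
        rw [translate_domino] at hmem ⊢
        rw [translate_domino]
        rcases Sym2.mem_iff.1 hmem with h1 | h1
        · exact absurd (h1 ▸ (hL.black_add_iff hu' _).2 (b i').2.2) hp
        -- Two dominoes covering the same white square have black squares with equal image under
        -- `σ`.
        · have hσ : σ i = σ i' := white_index_unique w <| by
            have e : (w (σ i) : ℤ × ℤ) - w (σ i') =
                ((b i' : ℤ × ℤ) + step (f i') - w (σ i')) -
                  ((b i : ℤ × ℤ) + step (f i) - w (σ i)) + (u' - u) := by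
              rw [hu, h1]
              abel
            rw [e]
            exact add_mem (sub_mem (h i') (h i)) (sub_mem hu' huL)
          obtain rfl := σ.injective hσ
          rw [show u' = u by
            rw [hu, h1]
            abel]
  · rintro v hv _ ⟨i, u, hu, rfl⟩
    exact ⟨i, u + v, add_mem hu hv, translate_translate _ _ _⟩

theorem eq_tilingOf {t : Set (Sym2 (ℤ × ℤ))} (ht : t ∈ torusTilings L) {f : Fin n → Fin 4}
    (hf : HasDirections b t f) : t = tilingOf b f := by
  ext d
  constructor
  · intro hd
    obtain ⟨p, hp, hpd⟩ : ∃ p, Black p ∧ p ∈ d := by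
      obtain ⟨p, δ, hδ, rfl⟩ := ht.1.1 d hd
      obtain ⟨e, rfl⟩ := mem_unitSteps_iff.1 hδ
      by_cases hp : Black p
      · exact ⟨p, hp, Sym2.mem_mk_left _ _⟩
      · exact ⟨p + step e, (black_add_step p e).2 hp, Sym2.mem_mk_right _ _⟩
    obtain ⟨i, u, hu, rfl⟩ := exists_black_translate b hL hp
    refine ⟨i, u, hu, (ht.1.2 ((b i : ℤ × ℤ) + u)).unique ⟨hd, hpd⟩ ⟨?_, ?_⟩⟩
    · exact ht.2 u hu _ ((hf i _).2 rfl)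
    · exact Sym2.mem_mk_left _ _
  · rintro ⟨i, u, hu, rfl⟩
    exact ht.2 u hu _ ((hf i _).2 rfl)

theorem exists_matching_of_mem_torusTilings {t : Set (Sym2 (ℤ × ℤ))} (ht : t ∈ torusTilings L) :
    ∃ f σ, HasDirections b t f ∧ (torusMap hL b w).IsMatching f σ := by
  choose f hf hfu using fun i => ht.1.existsUnique_step (b i : ℤ × ℤ)
  have hdir : HasDirections b t f := fun i d => ⟨fun h => (hfu i d h).symm, fun h => h ▸ hf i⟩
  -- If two black squares had the same white partner modulo `L`, a translate of one domino would
  -- overlap the other, hence equal it.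
  have hinj : Function.Injective fun i => whiteNeighbour hL b w i (f i) := by
    intro i i' h
    have h2 := (whiteNeighbour_eq_iff hL b w).1 h
    have hu := sub_mem h2 (whiteNeighbour_spec hL b w i' (f i'))
    rw [sub_sub_sub_cancel_right] at hu
    have h3 := (ht.1.2 ((b i : ℤ × ℤ) + step (f i))).unique
      ⟨hf i, Sym2.mem_mk_right _ _⟩ ⟨ht.2 _ hu _ (hf i'), by
        rw [translate_mk, add_sub_cancel]
        exact Sym2.mem_mk_right _ _⟩
    rw [translate_domino,
      domino_eq_iff (b i).2.2 ((hL.black_add_iff hu _).2 (b i').2.2)] at h3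
    refine black_index_unique b ?_
    rw [sub_eq_of_eq_add' h3.1]
    exact hu
  refine ⟨f, Equiv.ofBijective _ (Finite.injective_iff_bijective.1 hinj), hdir, ?_⟩
  rw [isMatching_iff]
  intro i
  exact whiteNeighbour_spec hL b w i (f i)

/-- Two tilings with the same flux have a height difference on the torus. -/
theorem exists_isDifference {t t' : Set (Sym2 (ℤ × ℤ))} {φ : ℝ × ℝ}
    (ht : t ∈ tilingsWithFlux L φ) (ht' : t' ∈ tilingsWithFlux L φ) {f f' : Fin n → Fin 4}
    (hf : HasDirections b t f) (hf' : HasDirections b t' f') :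
    ∃ g, (torusMap hL b w).IsDifference g f f' := by
  obtain ⟨-, h, hh, hφ⟩ := ht
  obtain ⟨-, h', hh', hφ'⟩ := ht'
  -- The jump along an edge modulo 4 does not depend on the tiling.
  have hdvd : ∀ v, (4 : ℤ) ∣ h v - h' v := by
    refine grid_induction ?_ fun e => ?_
    · rw [hh.1, hh'.1, sub_self]
      exact dvd_zero _
    · have h1 := hh.2 e
      have h2 := hh'.2 e
      split_ifs at h1 h2 <;> omega
  choose q hq using hdvd
  -- Equal fluxes make the difference periodic, so it descends to the torus.
  have hper : ∀ v v', v - v' ∈ L → q v = q v' := by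
    intro v v' hu
    have h1 := (hφ v' _ hu).trans (hφ' v' _ hu).symm
    rw [add_sub_cancel] at h1
    have h2 : h v - h v' = h' v - h' v' := by exact_mod_cast h1
    linarith [hq v, hq v']
  refine ⟨fun x => q x.out, fun i d => ?_⟩
  have hg : ∀ d, q ((torusMap hL b w).tgt (i, d)).out = q ((b i : ℤ × ℤ) + corner d) :=
    fun d => hper _ _ (mk_eq_mk_iff.1 (QuotientAddGroup.out_eq' _))
  simp only [hg]
  have h1 := hh.jump_black (b i).2.2 d
  have h2 := hh'.jump_black (b i).2.2 d
  rw [hf i d] at h1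
  rw [hf' i d] at h2
  have h3 := hq ((b i : ℤ × ℤ) + corner d)
  have h4 := hq ((b i : ℤ × ℤ) + corner (d + 1))
  split_ifs at h1 h2 ⊢ <;> omega

/-! ### The exponents of the term of a tiling -/

/-- A domino of `t` lies over exactly one black index, so a crossed edge is counted once even though
classes are taken modulo `L`. -/
theorem sum_crossed_eq {t : Set (Sym2 (ℤ × ℤ))} (ht : t ∈ torusTilings L) {f : Fin n → Fin 4}
    (hf : HasDirections b t f) (e : GridEdge) (c : ℤ) :
    (∑ i, if ∃ v ∈ L, translate v s((b i : ℤ × ℤ), (b i : ℤ × ℤ) + step (f i)) = e.crossed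
      then c else 0) = if e.crossed ∈ t then c else 0 := by
  split_ifs with he
  · rw [eq_tilingOf hL b ht hf] at he
    obtain ⟨i, u, hu, h⟩ := he
    rw [Finset.sum_eq_single i, if_pos ⟨u, hu, h.symm⟩]
    · intro i' _ hi
      refine if_neg ?_
      rintro ⟨v, hv, h'⟩
      rw [h, translate_domino, translate_domino,
        domino_eq_iff ((hL.black_add_iff hv _).2 (b i').2.2)
          ((hL.black_add_iff hu _).2 (b i).2.2)] at h'
      refine hi (black_index_unique b ?_)
      rw [sub_eq_sub_iff_add_eq_add.2 (h'.1.trans (add_comm _ _))]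
      exact sub_mem hu hv
    · simp
  · refine Finset.sum_eq_zero fun i _ => if_neg ?_
    rintro ⟨v, hv, h⟩
    exact he (h ▸ ht.2 v hv _ ((hf i _).2 rfl))

theorem sum_crossingExponent {t : Set (Sym2 (ℤ × ℤ))} (ht : t ∈ torusTilings L)
    {f : Fin n → Fin 4} (hf : HasDirections b t f) (γ : List GridEdge) :
    ∑ i, crossingExponent L γ s((b i : ℤ × ℤ), (b i : ℤ × ℤ) + step (f i)) =
      signedCrossings t γ := by
  induction γ with
  | nil => simp [crossingExponent, signedCrossings]
  | cons e γ ih =>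
    have := sum_crossed_eq hL b ht hf e (if Black e.rightSquare then -1 else 1)
    simp only [crossingExponent, signedCrossings, List.map_cons, List.sum_cons] at ih ⊢
    rw [Finset.sum_add_distrib, ih, this]

end TorusDomino

namespace TorusDomino

open Equiv
open scoped Classical

/-! ### The expansion of the Kasteleyn determinant -/

variable {L : AddSubgroup (ℤ × ℤ)} (hL : IsValidLattice L) {n : ℕ}
  (b : Fin n ≃ blackSquares L) (w : Fin n ≃ whiteSquares L)

/-- The sign of the term of the expansion of the Kasteleyn determinant that belongs to the
permutation `σ` and the directions `f`, for the brick wall of direction `d`. -/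
def termSign (d : Fin 4) (η : ℤˣ) (f : Fin n → Fin 4) (σ : Perm (Fin n)) : ℤˣ :=
  Perm.sign σ * (∏ i, if f i = d then (-1 : ℤˣ) else 1) * η ^ n

theorem kasteleynSign_domino {p : ℤ × ℤ} (hp : Black p) (d e : Fin 4) (η : ℤˣ) :
    kasteleynSign (step d) η s(p, p + step e) = (((if e = d then -1 else 1) * η : ℤˣ) : ℤ) := by
  have : s(p, p + step e) ∈ brickWall (step d) ↔ e = d := by
    constructor
    · rintro ⟨q, hq, h⟩
      exact ((domino_eq_iff hp hq).1 h).2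
    · rintro rfl
      exact ⟨p, hp, rfl⟩
  rw [kasteleynSign]
  simp only [this]
  split_ifs <;> simp

theorem term_eq_single (hL : IsValidLattice L) (d : Fin 4) (η : ℤˣ) {f : Fin n → Fin 4}
    {σ : Perm (Fin n)} {t : Set (Sym2 (ℤ × ℤ))} (ht : t ∈ torusTilings L)
    (hf : HasDirections b t f) :
    ((Perm.sign σ : ℤˣ) : ℤ) •
      ∏ i, weight L (step d) η s((b i : ℤ × ℤ), (b i : ℤ × ℤ) + step (f i)) =
    AddMonoidAlgebra.single (signedCrossings t (path0 L), signedCrossings t (path1 L))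
      ((termSign d η f σ : ℤˣ) : ℤ) := by
  simp only [weight]
  rw [AddMonoidAlgebra.prod_single, AddMonoidAlgebra.smul_single]
  congr 1
  · ext
    · rw [Prod.fst_sum]
      exact sum_crossingExponent hL b ht hf _
    · rw [Prod.snd_sum]
      exact sum_crossingExponent hL b ht hf _
  · simp only [fun i => kasteleynSign_domino (b i).2.2 d (f i) η]
    rw [termSign, ← Units.coe_prod, Finset.prod_mul_distrib, smul_eq_mul, ← Units.val_mul,
      Finset.prod_const, Finset.card_univ, Fintype.card_fin, mul_assoc]

/-- Expanding the entries too gives one term per permutation and choice of directions, so parallel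
edges between the same two squares modulo `L` are kept apart. -/
theorem det_kasteleynMatrix (β : ℤ × ℤ) (η : ℤˣ) :
    (kasteleynMatrix L β η b w).det =
      ∑ x : Perm (Fin n) × (Fin n → Fin 4),
        if (torusMap hL b w).IsMatching x.2 x.1 then
          ((Perm.sign x.1 : ℤˣ) : ℤ) •
            ∏ i, weight L β η s((b i : ℤ × ℤ), (b i : ℤ × ℤ) + step (x.2 i))
        else 0 := by
  -- The transpose turns the products of `Matrix.det_apply` into products of entries `(i, σ i)`.
  rw [← Matrix.det_transpose, Matrix.det_apply, Fintype.sum_prod_type]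
  refine Finset.sum_congr rfl fun σ _ => ?_
  simp only [Matrix.transpose_apply, kasteleynMatrix, unitSteps_eq_image,
    Finset.sum_image step_injective.injOn, Finset.prod_univ_sum, Fintype.piFinset_univ]
  rw [Finset.smul_sum]
  refine Finset.sum_congr rfl fun f _ => ?_
  rw [Finset.prod_ite_zero, isMatching_iff]
  simp only [Finset.mem_univ, true_imp_iff]
  split_ifs
  · rw [Units.smul_def]
  · rw [smul_zero]

/-- The pairs of a permutation and directions that belong to the tilings with flux `φ`. -/
noncomputable def fluxTerms (φ : ℝ × ℝ) : Finset (Perm (Fin n) × (Fin n → Fin 4)) :=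
  {x | (torusMap hL b w).IsMatching x.2 x.1 ∧ tilingOf b x.2 ∈ tilingsWithFlux L φ}

theorem mem_fluxTerms {φ : ℝ × ℝ} {x : Perm (Fin n) × (Fin n → Fin 4)} :
    x ∈ fluxTerms hL b w φ ↔
      (torusMap hL b w).IsMatching x.2 x.1 ∧ tilingOf b x.2 ∈ tilingsWithFlux L φ := by
  rw [fluxTerms, Finset.mem_filter, and_iff_right (Finset.mem_univ _)]

/-- A tiling determines its directions, and these determine the permutation. -/
theorem card_fluxTerms (φ : ℝ × ℝ) :
    ((fluxTerms hL b w φ).card : ℕ∞) = (tilingsWithFlux L φ).encard := by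
  rw [← Set.encard_coe_eq_coe_finsetCard]
  have himg : (fun x : Perm (Fin n) × (Fin n → Fin 4) => tilingOf b x.2) ''
      (fluxTerms hL b w φ : Set (Perm (Fin n) × (Fin n → Fin 4))) = tilingsWithFlux L φ := by
    ext t
    constructor
    · rintro ⟨x, hx, rfl⟩
      exact ((mem_fluxTerms hL b w).1 (Finset.mem_coe.1 hx)).2
    · intro ht
      obtain ⟨f, σ, hf, hm⟩ := exists_matching_of_mem_torusTilings hL b w ht.1
      have := eq_tilingOf hL b ht.1 hf
      exact ⟨(σ, f), Finset.mem_coe.2 ((mem_fluxTerms hL b w).2 ⟨hm, this ▸ ht⟩),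
        this.symm⟩
  rw [← himg, Set.InjOn.encard_image]
  rintro ⟨σ, f⟩ hx ⟨σ', f'⟩ hx' (h : tilingOf b f = tilingOf b f')
  have h1 := ((mem_fluxTerms hL b w).1 (Finset.mem_coe.1 hx)).1
  have h2 := ((mem_fluxTerms hL b w).1 (Finset.mem_coe.1 hx')).1
  have hff : f = f' := by
    funext i
    have h3 := (hasDirections_tilingOf hL b f i (f i)).2 rfl
    rw [h] at h3
    exact ((hasDirections_tilingOf hL b f' i (f i)).1 h3).symm
  subst hff
  exact Prod.ext (h1.perm_unique h2) rfl

theorem coeff_det_kasteleynMatrix (d : Fin 4) (η : ℤˣ) {φ : ℝ × ℝ} {i j : ℤ}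
    (hc : CorrespondsToFlux L φ i j) :
    (kasteleynMatrix L (step d) η b w).det.coeff (i, j) =
      ∑ x ∈ fluxTerms hL b w φ, ((termSign d η x.2 x.1 : ℤˣ) : ℤ) := by
  rw [det_kasteleynMatrix hL, AddMonoidAlgebra.coeff_sum, Finsupp.finsetSum_apply, fluxTerms,
    Finset.sum_filter]
  refine Finset.sum_congr rfl fun x _ => ?_
  by_cases hm : (torusMap hL b w).IsMatching x.2 x.1
  · have ht := tilingOf_mem_torusTilings hL b w hm
    rw [if_pos hm, term_eq_single b hL d η ht (hasDirections_tilingOf hL b x.2),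
      AddMonoidAlgebra.coeff_single, Finsupp.single_apply]
    refine if_congr ?_ rfl rfl
    rw [Prod.mk.injEq, and_iff_right hm]
    constructor
    · rintro ⟨rfl, rfl⟩
      exact mem_tilingsWithFlux_of_correspondsToFlux hL ht hc
    · exact fun h => (correspondsToFlux_of_mem hL h).unique hc
  · rw [if_neg hm, if_neg fun h => hm h.1]
    simp

theorem termSign_eq (d : Fin 4) (η : ℤˣ) {φ : ℝ × ℝ} {t t' : Set (Sym2 (ℤ × ℤ))}
    (ht : t ∈ tilingsWithFlux L φ) (ht' : t' ∈ tilingsWithFlux L φ) {f f' : Fin n → Fin 4}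
    {σ σ' : Perm (Fin n)} (hf : HasDirections b t f) (hf' : HasDirections b t' f')
    (hm : (torusMap hL b w).IsMatching f σ) (hm' : (torusMap hL b w).IsMatching f' σ') :
    termSign d η f σ = termSign d η f' σ' := by
  have := hL.finite_quotient
  have := Fintype.ofFinite ((ℤ × ℤ) ⧸ L)
  obtain ⟨g, hg⟩ := exists_isDifference hL b w ht ht' hf hf'
  rw [termSign, termSign, hg.sign_mul_prod_eq hm hm' d]

end TorusDomino

open TorusDomino in
theorem mainTheorem5 (L : AddSubgroup (ℤ × ℤ)) (hL : TorusDomino.IsValidLattice L)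
    (β : ℤ × ℤ) (hβ : β ∈ TorusDomino.unitSteps) (η : ℤˣ) (n : ℕ)
    (b : Fin n ≃ TorusDomino.blackSquares L) (w : Fin n ≃ TorusDomino.whiteSquares L)
    (φ : ℝ × ℝ) (hφ : φ ∈ TorusDomino.fluxSet L) :
    ∃ i j : ℤ, TorusDomino.CorrespondsToFlux L φ i j ∧
      (∃ ε : ℤˣ, ∀ t ∈ TorusDomino.tilingsWithFlux L φ,
        TorusDomino.IsExpansionTerm L β η b w t (AddMonoidAlgebra.single (i, j) (ε : ℤ))) ∧
      (((TorusDomino.kasteleynMatrix L β η b w).det.coeff (i, j)).natAbs : ℕ∞) =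
        (TorusDomino.tilingsWithFlux L φ).encard := by
  obtain ⟨d, rfl⟩ := mem_unitSteps_iff.1 hβ
  obtain ⟨t₀, ht₀⟩ := hφ
  obtain ⟨f₀, σ₀, hf₀, hm₀⟩ := exists_matching_of_mem_torusTilings hL b w ht₀.1
  have hc := correspondsToFlux_of_mem hL ht₀
  refine ⟨_, _, hc, ⟨termSign d η f₀ σ₀, fun t ht => ?_⟩, ?_⟩
  · obtain ⟨f, σ, hf, hm⟩ := exists_matching_of_mem_torusTilings hL b w ht.1
    refine ⟨σ, fun i => step (f i), fun i => ⟨step_mem_unitSteps _, (hf i _).2 rfl,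
      (isMatching_iff hL b w).1 hm i⟩, ?_⟩
    rw [term_eq_single b hL d η ht.1 hf, termSign_eq hL b w d η ht ht₀ hf hf₀ hm hm₀]
    obtain ⟨h0, h1⟩ := (correspondsToFlux_of_mem hL ht).unique hc
    rw [h0, h1]
  -- All contributing terms have the sign of the reference tiling `t₀`, so the coefficient is a unit
  -- times their number.
  · rw [← card_fluxTerms hL b w, coeff_det_kasteleynMatrix hL b w d η hc,
      Finset.sum_congr rfl (g := fun _ => ((termSign d η f₀ σ₀ : ℤˣ) : ℤ)) fun x hx => ?_,
      Finset.sum_const, nsmul_eq_mul, Int.natAbs_mul, Int.units_natAbs, mul_one, Int.natAbs_natCast]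
    obtain ⟨hm, ht⟩ := (mem_fluxTerms hL b w).1 hx
    rw [termSign_eq hL b w d η ht ht₀ (hasDirections_tilingOf hL b x.2) hf₀ hm hm₀]
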